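/- Let $n\ge 1$, $A\in\mathbb{R}^{n\times n}$, $B\in\mathbb{R}^{n\times 1}$, $T>0$, and consider the system $\dot x(t)=Ax(t)+Bu(t)$ with scalar control $u$. Let $0\le U_{\min}=U_1<U_2<\dots<U_N=1$, and let $w_1,\dots,w_N\ge 0$ be weights with $w_1>0$ and $\sum_{i=1}^N w_i=1$. For $\xi\in\mathbb{R}^n$ let $\mathcal{U}(\xi)$ be the set of measurable controls $u$ on $[0,T]$ with $\|u\|_\infty\le 1$ that steer the state from $x(0)=\xi$ to $x(T)=0$. A control is called SOAV (sum-of-absolute-values) optimal for $\xi$ if it minimizes $$J(u)=\sum_{i=1}^{N}w_i\int_0^T\bigl(|u(t)-U_i|+|u(t)+U_i|\bigr)\,dt$$ over $u\in\mathcal{U}(\xi)$. Let $0=t_0<t_1<t_2<\cdots$ be sampling instants for which there is $\tau>0$ with $\tau\le t_{k+1}-t_k\le T$ for all $k\ge 0$. In the closed loop under receding-horizon SOAV model predictive control, at each $t_k$ an SOAV optimal control $u_k$ for the initial state $\xi=x(t_k)$ is chosen, and $u(t)=u_k(t-t_k)$ is applied for $t\in[t_k,t_{k+1})$. Suppose that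 the pair $(A,B)$ is controllable and $U_{\min}=0$. Then, for every choice of such sampling instants, the origin is stable in the sense of Lyapunov for the closed loop: for every $\varepsilon>0$ there is $\delta>0$ such that for every initial state $\xi$ with $\|\xi\|<\delta$ the closed loop has a trajectory on $[0,\infty)$ with $x(0)=\xi$, and every such trajectory (whichever optimal controls are chosen) satisfies $\|x(t)\|<\varepsilon$ for all $t\ge 0$. -/

import Mathlib

open MeasureTheory

/-- `x` is a (Carathéodory) solution on the time set `S` (below `[0, T]` or `[0, ∞)`) of
`x' = A x + B u` with `u` a locally integrable scalar control: `x` is continuous and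
`x t = x 0 + ∫₀ᵗ (A x(s) + B u(s)) ds` for `t ∈ S`. The one-column matrix `B` is given as a
vector. -/
def IsTrajectory {n : ℕ} (A : Matrix (Fin n) (Fin n) ℝ) (B : EuclideanSpace ℝ (Fin n))
    (u : ℝ → ℝ) (S : Set ℝ) (x : ℝ → EuclideanSpace ℝ (Fin n)) : Prop :=
  ContinuousOn x S ∧
    ∀ t ∈ S, IntervalIntegrable u volume 0 t ∧
      x t = x 0 + ∫ s in (0 : ℝ)..t, (Matrix.toEuclideanLin A (x s) + u s • B)

/-- The pair `(A, B)` is controllable: every state can be steered to every other state in some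
finite time (by an integrable control, without magnitude constraint). -/
def IsControllable {n : ℕ} (A : Matrix (Fin n) (Fin n) ℝ)
    (B : EuclideanSpace ℝ (Fin n)) : Prop :=
  ∀ ξ η : EuclideanSpace ℝ (Fin n), ∃ S : ℝ, 0 < S ∧
    ∃ (u : ℝ → ℝ) (x : ℝ → EuclideanSpace ℝ (Fin n)),
      IsTrajectory A B u (Set.Icc 0 S) x ∧ x 0 = ξ ∧ x S = η

/-- `u` is a feasible control for the initial state `ξ` and the horizon `T`: it is measurable
on `[0, T]`, satisfies `‖u‖_∞ ≤ 1` there, and steers `ξ` to the origin at time `T`. -/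
def IsFeasible {n : ℕ} (A : Matrix (Fin n) (Fin n) ℝ) (B : EuclideanSpace ℝ (Fin n))
    (T : ℝ) (ξ : EuclideanSpace ℝ (Fin n)) (u : ℝ → ℝ) : Prop :=
  AEMeasurable u (volume.restrict (Set.Icc 0 T)) ∧
    (∀ᵐ s ∂(volume.restrict (Set.Icc 0 T)), |u s| ≤ 1) ∧
    ∃ x : ℝ → EuclideanSpace ℝ (Fin n),
      IsTrajectory A B u (Set.Icc 0 T) x ∧ x 0 = ξ ∧ x T = 0

/-- The sum-of-absolute-values cost
`J(u) = ∑_{i=1}^N w_i (‖u - U_i‖₁ + ‖u + U_i‖₁)`, with `L¹` norms over `[0, T]`. -/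
noncomputable def soavCost (N : ℕ) (U w : ℕ → ℝ) (T : ℝ) (u : ℝ → ℝ) : ℝ :=
  ∑ i ∈ Finset.Icc 1 N,
    w i * ((∫ s in (0 : ℝ)..T, |u s - U i|) + ∫ s in (0 : ℝ)..T, |u s + U i|)

/-- `u` is an SOAV optimal control for the initial state `ξ`: it minimizes the cost among all
feasible controls for `ξ`. -/
def IsSOAVOptimal {n : ℕ} (A : Matrix (Fin n) (Fin n) ℝ) (B : EuclideanSpace ℝ (Fin n))
    (N : ℕ) (U w : ℕ → ℝ) (T : ℝ) (ξ : EuclideanSpace ℝ (Fin n)) (u : ℝ → ℝ) : Prop :=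
  IsFeasible A B T ξ u ∧
    ∀ v : ℝ → ℝ, IsFeasible A B T ξ v → soavCost N U w T u ≤ soavCost N U w T v

/-- Admissible sampling instants: `0 = t₀ < t₁ < ⋯` and, for some `τ > 0`,
`τ ≤ t_{k+1} - t_k ≤ T` for all `k`. -/
def IsSampling (T : ℝ) (t : ℕ → ℝ) : Prop :=
  t 0 = 0 ∧ StrictMono t ∧ ∃ τ : ℝ, 0 < τ ∧ ∀ k, τ ≤ t (k + 1) - t k ∧ t (k + 1) - t k ≤ T

/-- `x` is a trajectory on `[0, ∞)`, started at `ξ`, of the closed loop under receding-horizon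
SOAV control: at each `t_k` an SOAV optimal control `v k` for the current state `x (t_k)` is
chosen, and `u(s) = v_k(s - t_k)` is applied for `t_k ≤ s < t_{k+1}`. -/
def IsMPCTrajectory {n : ℕ} (A : Matrix (Fin n) (Fin n) ℝ) (B : EuclideanSpace ℝ (Fin n))
    (N : ℕ) (U w : ℕ → ℝ) (T : ℝ) (t : ℕ → ℝ) (ξ : EuclideanSpace ℝ (Fin n))
    (x : ℝ → EuclideanSpace ℝ (Fin n)) : Prop :=
  x 0 = ξ ∧ ∃ (v : ℕ → ℝ → ℝ) (u : ℝ → ℝ),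
    (∀ k, IsSOAVOptimal A B N U w T (x (t k)) (v k)) ∧
    (∀ k, ∀ s ∈ Set.Ico (t k) (t (k + 1)), u s = v k (s - t k)) ∧
    IsTrajectory A B u (Set.Ici 0) x

/-- The origin is Lyapunov stable for the closed loop with sampling instants `t`: for every
`ε > 0` there is `δ > 0` such that from every `ξ` with `‖ξ‖ < δ` the closed loop has a
trajectory on `[0, ∞)`, and every one (whichever optimal controls are chosen) stays in the
`ε`-ball. -/
def IsMPCLyapunovStable {n : ℕ} (A : Matrix (Fin n) (Fin n) ℝ)
    (B : EuclideanSpace ℝ (Fin n)) (N : ℕ) (U w : ℕ → ℝ) (T : ℝ) (t : ℕ → ℝ) : Prop :=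
  ∀ ε : ℝ, 0 < ε → ∃ δ : ℝ, 0 < δ ∧ ∀ ξ : EuclideanSpace ℝ (Fin n), ‖ξ‖ < δ →
    (∃ x, IsMPCTrajectory A B N U w T t ξ x) ∧
    ∀ x, IsMPCTrajectory A B N U w T t ξ x → ∀ s : ℝ, 0 ≤ s → ‖x s‖ < ε

/-! The optimal cost is a Lyapunov function comparable to the `L¹` norm of the control. Let `g` be
the running cost. Since `U 1 = 0` and every term `|v - U i| + |v + U i|` is smallest at `v = 0`, one
has `g 0 + 2 * w 1 * |v| ≤ g v ≤ g 0 + 2 * |v|`. Up to the constant `T * g 0`, the cost therefore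
lies between `2 * w 1` and `2` times the `L¹` norm (`le_soavCost`, `soavCost_le`).

Advancing an optimal control by the sampling step and continuing it by zero gives a feasible control
for the next state. The appended zeros cost no more than the removed initial piece, so the optimal
cost decreases along the closed loop (`soavCost_antitone_of_mpc`). Controllability supplies a first
control of size `O(‖ξ‖)`, through the inverse of the Gramian (`exists_continuous_control`), so all
later optimal controls have `L¹` norm `O(‖ξ‖)`. A trajectory that ends at the origin is bounded
throughout by the `L¹` norm of its control (`exists_norm_flow_le_of_flow_eq_zero`), and this bounds
the closed-loop state.

Closed-loop trajectories exist because feasibility passes from one sampling instant to the next and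
optimal controls exist: a continuous convex function attains its minimum on a closed bounded convex
subset of `L²` (`exists_isSOAVOptimal`). -/

/-! ### The operator exponential and variation of constants -/

section Propagator

variable {E : Type*} [NormedAddCommGroup E] [NormedSpace ℝ E]

/-- The one-parameter group `exp (t L)` generated by a bounded operator `L`. -/
noncomputable def propagator (L : E →L[ℝ] E) (t : ℝ) : E →L[ℝ] E := NormedSpace.exp (t • L)

theorem propagator_zero (L : E →L[ℝ] E) : propagator L 0 = 1 := by
  simp [propagator]

theorem continuousOn_integral {f : ℝ → E} {S : ℝ} (hS : 0 ≤ S)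
    (hf : IntervalIntegrable f volume 0 S) :
    ContinuousOn (fun r => ∫ s in (0 : ℝ)..r, f s) (Set.Icc 0 S) := by
  have := intervalIntegral.continuousOn_primitive_interval' hf (a := 0) Set.left_mem_uIcc
  rwa [Set.uIcc_of_le hS] at this

theorem intervalIntegrable_of_continuousOn_Icc {F : Type*} [NormedAddCommGroup F]
    {f : ℝ → F} {S t : ℝ}
    (hf : ContinuousOn f (Set.Icc 0 S)) (ht : t ∈ Set.Icc 0 S) :
    IntervalIntegrable f volume 0 t := by
  refine (hf.mono ?_).intervalIntegrable
  rw [Set.uIcc_of_le ht.1]; exact Set.Icc_subset_Icc_right ht.2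

variable [CompleteSpace E]

theorem hasDerivAt_propagator (L : E →L[ℝ] E) (t : ℝ) :
    HasDerivAt (propagator L) (propagator L t * L) t :=
  hasDerivAt_exp_smul_const L t

theorem hasDerivAt_propagator' (L : E →L[ℝ] E) (t : ℝ) :
    HasDerivAt (propagator L) (L * propagator L t) t :=
  hasDerivAt_exp_smul_const' L t

theorem continuous_propagator (L : E →L[ℝ] E) : Continuous (propagator L) :=
  continuous_iff_continuousAt.2 fun t => (hasDerivAt_propagator L t).continuousAt

theorem propagator_mul_neg (L : E →L[ℝ] E) (t : ℝ) :
    propagator L t * propagator L (-t) = 1 := by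
  have : Commute (t • L) ((-t) • L) :=
    ((Commute.refl L).smul_left t).smul_right (-t)
  let _ : NormedAlgebra ℚ (E →L[ℝ] E) := NormedAlgebra.restrictScalars ℚ ℝ _
  rw [propagator, propagator, ← NormedSpace.exp_add_of_commute this]
  simp

theorem propagator_apply_neg (L : E →L[ℝ] E) (t : ℝ) (x : E) :
    propagator L t (propagator L (-t) x) = x := by
  have := congrArg (fun M : E →L[ℝ] E => M x) (propagator_mul_neg L t)
  simpa using this

theorem propagator_neg_apply (L : E →L[ℝ] E) (t : ℝ) (x : E) :
    propagator L (-t) (propagator L t x) = x := by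
  simpa using propagator_apply_neg L (-t) x

theorem hasDerivAt_propagator_neg (L : E →L[ℝ] E) (t : ℝ) :
    HasDerivAt (fun s => propagator L (-s)) (-(propagator L (-t) * L)) t := by
  have := (hasDerivAt_propagator L (-t)).scomp t (hasDerivAt_neg t)
  simpa [Function.comp_def] using this

theorem continuous_propagator_neg (L : E →L[ℝ] E) :
    Continuous fun s => propagator L (-s) :=
  (continuous_propagator L).comp continuous_neg

/-- Along a solution of `y' = L y + f`, the pulled-back state `exp (-t L) y` has
derivative `exp (-t L) f`. -/
theorem hasDerivAt_propagator_neg_apply {L : E →L[ℝ] E} {y : ℝ → E} {f : E} {t : ℝ}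
    (hy : HasDerivAt y (L (y t) + f) t) :
    HasDerivAt (fun s => propagator L (-s) (y s)) (propagator L (-t) f) t := by
  have := (hasDerivAt_propagator_neg L t).clm_apply hy
  convert this using 1
  simp

theorem hasDerivAt_integral_of_continuousOn {f : ℝ → E} {S t : ℝ}
    (hf : ContinuousOn f (Set.Icc 0 S)) (ht : t ∈ Set.Ioo 0 S) :
    HasDerivAt (fun r => ∫ s in (0 : ℝ)..r, f s) (f t) t := by
  have hsub : Set.uIcc 0 t ⊆ Set.Icc 0 S := by
    rw [Set.uIcc_of_le ht.1.le]; exact Set.Icc_subset_Icc_right ht.2.le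
  refine intervalIntegral.integral_hasDerivAt_right (hf.mono hsub).intervalIntegrable
    ((hf.mono Set.Ioo_subset_Icc_self).stronglyMeasurableAtFilter isOpen_Ioo t ht) ?_
  exact hf.continuousAt (Icc_mem_nhds ht.1 ht.2)

/-- Variation of constants, giving uniqueness; the next theorem is the converse, giving existence.
Continuity of `f` makes `y` differentiable inside the interval, so the pulled-back state can be
integrated. -/
theorem eq_propagator_of_integral_eq {L : E →L[ℝ] E} {f y : ℝ → E} {S : ℝ}
    (hf : ContinuousOn f (Set.Icc 0 S)) (hy : ContinuousOn y (Set.Icc 0 S))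
    (h : ∀ t ∈ Set.Icc 0 S, y t = y 0 + ∫ s in (0 : ℝ)..t, (L (y s) + f s))
    {t : ℝ} (ht : t ∈ Set.Icc 0 S) :
    y t = propagator L t (y 0 + ∫ s in (0 : ℝ)..t, propagator L (-s) (f s)) := by
  have hF : ContinuousOn (fun s => L (y s) + f s) (Set.Icc 0 S) :=
    (L.continuous.comp_continuousOn hy).add hf
  have hd : ∀ r ∈ Set.Ioo 0 S, HasDerivAt y (L (y r) + f r) r := by
    intro r hr
    refine ((hasDerivAt_integral_of_continuousOn hF hr).const_add (y 0)).congr_of_eventuallyEq ?_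
    filter_upwards [Icc_mem_nhds hr.1 hr.2] with q hq using h q hq
  have hsub : Set.Icc 0 t ⊆ Set.Icc 0 S := Set.Icc_subset_Icc_right ht.2
  have key := intervalIntegral.integral_eq_sub_of_hasDerivAt_of_le ht.1
    (f := fun s => propagator L (-s) (y s)) (f' := fun s => propagator L (-s) (f s))
    ((continuous_propagator_neg L).continuousOn.clm_apply (hy.mono hsub))
    (fun r hr => hasDerivAt_propagator_neg_apply (hd r ⟨hr.1, hr.2.trans_le ht.2⟩))
    (intervalIntegrable_of_continuousOn_Icc
      ((continuous_propagator_neg L).continuousOn.clm_apply hf) ht)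
  rw [key]
  simp [propagator_zero, propagator_apply_neg]

theorem integral_eq_of_eq_propagator {L : E →L[ℝ] E} {f y : ℝ → E} {S : ℝ} {ξ : E}
    (hf : ContinuousOn f (Set.Icc 0 S))
    (h : ∀ t ∈ Set.Icc 0 S,
      y t = propagator L t (ξ + ∫ s in (0 : ℝ)..t, propagator L (-s) (f s))) :
    ContinuousOn y (Set.Icc 0 S) ∧
      ∀ t ∈ Set.Icc 0 S, y t = ξ + ∫ s in (0 : ℝ)..t, (L (y s) + f s) := by
  have hg : ContinuousOn (fun s => propagator L (-s) (f s)) (Set.Icc 0 S) :=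
    (continuous_propagator_neg L).continuousOn.clm_apply hf
  have hy : ContinuousOn y (Set.Icc 0 S) := by
    rcases lt_or_ge S 0 with hS | hS
    · simp [Set.Icc_eq_empty (not_le.2 hS)]
    refine ContinuousOn.congr ((continuous_propagator L).continuousOn.clm_apply
      (continuousOn_const.add (continuousOn_integral hS
        (intervalIntegrable_of_continuousOn_Icc hg ⟨hS, le_rfl⟩)))) h
  refine ⟨hy, fun t ht => ?_⟩
  have hF : ContinuousOn (fun s => L (y s) + f s) (Set.Icc 0 S) :=
    (L.continuous.comp_continuousOn hy).add hf
  have hd : ∀ r ∈ Set.Ioo 0 S, HasDerivAt y (L (y r) + f r) r := by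
    intro r hr
    have h1 := (hasDerivAt_propagator' L r).clm_apply
      ((hasDerivAt_integral_of_continuousOn hg hr).const_add ξ)
    have h2 := h1.congr_of_eventuallyEq (f₁ := y) (by
      filter_upwards [Icc_mem_nhds hr.1 hr.2] with q hq using h q hq)
    convert h2 using 1
    rw [h r ⟨hr.1.le, hr.2.le⟩]
    simp [propagator_apply_neg]
  have hsub : Set.Icc 0 t ⊆ Set.Icc 0 S := Set.Icc_subset_Icc_right ht.2
  rw [intervalIntegral.integral_eq_sub_of_hasDerivAt_of_le ht.1 (hy.mono hsub)
    (fun r hr => hd r ⟨hr.1, hr.2.trans_le ht.2⟩) (intervalIntegrable_of_continuousOn_Icc hF ht)]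
  rw [h 0 ⟨le_rfl, ht.1.trans ht.2⟩]
  simp [propagator_zero]

theorem exists_norm_propagator_le (L : E →L[ℝ] E) (T : ℝ) :
    ∃ M : ℝ, 0 < M ∧ ∀ t, |t| ≤ T → ‖propagator L t‖ ≤ M := by
  obtain ⟨C, hC⟩ := (isCompact_Icc (a := -T) (b := T)).exists_bound_of_continuousOn
    (continuous_propagator L).continuousOn
  exact ⟨max C 1, by positivity, fun t ht => (hC t (abs_le.1 ht)).trans (le_max_left _ _)⟩

end Propagator

/-! ### Solutions for integrable controls and their `L¹` bounds -/

section Flow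

variable {E : Type*} [NormedAddCommGroup E] [NormedSpace ℝ E]

/-- The solution at time `t` of `x' = L x + u b`, `x 0 = ξ`. It is written through the primitive
`V` of `u` (`x - V b` solves an equation with the continuous forcing term `V L b`), so that it
makes sense for integrable `u`. -/
noncomputable def flow (L : E →L[ℝ] E) (b : E) (u : ℝ → ℝ) (ξ : E) (t : ℝ) : E :=
  (∫ r in (0 : ℝ)..t, u r) • b + propagator L t
    (ξ + ∫ s in (0 : ℝ)..t, propagator L (-s) ((∫ r in (0 : ℝ)..s, u r) • L b))

theorem flow_zero_time (L : E →L[ℝ] E) (b : E) (u : ℝ → ℝ) (ξ : E) : flow L b u ξ 0 = ξ := by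
  simp [flow, propagator_zero]

theorem flow_congr {L : E →L[ℝ] E} {b : E} {u v : ℝ → ℝ} {ξ : E} {t : ℝ} (ht : 0 ≤ t)
    (h : ∀ᵐ s, s ∈ Set.Ioc 0 t → u s = v s) : flow L b u ξ t = flow L b v ξ t := by
  have key : ∀ s ∈ Set.Icc 0 t, ∫ r in (0 : ℝ)..s, u r = ∫ r in (0 : ℝ)..s, v r := by
    intro s hs
    refine intervalIntegral.integral_congr_ae ?_
    filter_upwards [h] with r hr hrs
    rw [Set.uIoc_of_le hs.1] at hrs
    exact hr ⟨hrs.1, hrs.2.trans hs.2⟩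
  rw [flow, flow, key t ⟨ht, le_rfl⟩]
  congr 3
  refine intervalIntegral.integral_congr fun s hs => ?_
  rw [Set.uIcc_of_le ht] at hs
  simp only [key s hs]

theorem continuousOn_forcing (L : E →L[ℝ] E) (b : E) {u : ℝ → ℝ} {t : ℝ} (ht : 0 ≤ t)
    (hu : IntervalIntegrable u volume 0 t) :
    ContinuousOn (fun s => (∫ r in (0 : ℝ)..s, u r) • L b) (Set.Icc 0 t) :=
  (continuousOn_integral ht hu).smul continuousOn_const

variable [CompleteSpace E]

theorem continuousOn_pulledForcing (L : E →L[ℝ] E) (b : E) {u : ℝ → ℝ} {t : ℝ} (ht : 0 ≤ t)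
    (hu : IntervalIntegrable u volume 0 t) :
    ContinuousOn (fun s => propagator L (-s) ((∫ r in (0 : ℝ)..s, u r) • L b)) (Set.Icc 0 t) :=
  (continuous_propagator_neg L).continuousOn.clm_apply (continuousOn_forcing L b ht hu)

theorem flow_linear_combination (L : E →L[ℝ] E) (b : E) {u v : ℝ → ℝ} (ξ η : E) (c d : ℝ) {t : ℝ}
    (ht : 0 ≤ t) (hu : IntervalIntegrable u volume 0 t) (hv : IntervalIntegrable v volume 0 t) :
    flow L b (fun s => c * u s + d * v s) (c • ξ + d • η) t =
      c • flow L b u ξ t + d • flow L b v η t := by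
  have key : ∀ s ∈ Set.Icc 0 t, ∫ r in (0 : ℝ)..s, (c * u r + d * v r) =
      c * (∫ r in (0 : ℝ)..s, u r) + d * ∫ r in (0 : ℝ)..s, v r := by
    intro s hs
    have hsub : Set.uIcc 0 s ⊆ Set.uIcc 0 t := by
      rw [Set.uIcc_of_le hs.1, Set.uIcc_of_le ht]; exact Set.Icc_subset_Icc_right hs.2
    rw [intervalIntegral.integral_add ((hu.mono_set hsub).const_mul c)
      ((hv.mono_set hsub).const_mul d)]
    simp
  have key2 : ∫ s in (0 : ℝ)..t,
      propagator L (-s) ((∫ r in (0 : ℝ)..s, (c * u r + d * v r)) • L b) =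
      c • (∫ s in (0 : ℝ)..t, propagator L (-s) ((∫ r in (0 : ℝ)..s, u r) • L b)) +
      d • ∫ s in (0 : ℝ)..t, propagator L (-s) ((∫ r in (0 : ℝ)..s, v r) • L b) := by
    rw [← intervalIntegral.integral_smul, ← intervalIntegral.integral_smul,
      ← intervalIntegral.integral_add]
    · refine intervalIntegral.integral_congr fun s hs => ?_
      rw [Set.uIcc_of_le ht] at hs
      simp only [key s hs, map_add, map_smul, add_smul, mul_smul]
    · exact (intervalIntegrable_of_continuousOn_Icc (continuousOn_pulledForcing L b ht hu)
        ⟨ht, le_rfl⟩).smul c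
    · exact (intervalIntegrable_of_continuousOn_Icc (continuousOn_pulledForcing L b ht hv)
        ⟨ht, le_rfl⟩).smul d
  rw [flow, key2, key t ⟨ht, le_rfl⟩]
  simp only [flow, map_add, map_smul]
  module

theorem abs_integral_le_of_mem_Icc {u : ℝ → ℝ} {s t : ℝ} (hs : s ∈ Set.Icc 0 t)
    (hu : IntervalIntegrable u volume 0 t) :
    |∫ r in (0 : ℝ)..s, u r| ≤ ∫ r in (0 : ℝ)..t, |u r| := by
  refine (intervalIntegral.abs_integral_le_integral_abs hs.1).trans ?_
  refine intervalIntegral.integral_mono_interval le_rfl hs.1 hs.2 ?_ hu.abs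
  exact Filter.Eventually.of_forall fun r => abs_nonneg _

theorem exists_norm_pulledForcing_le (L : E →L[ℝ] E) (b : E) {T : ℝ} :
    ∃ C : ℝ, 0 ≤ C ∧ ∀ (u : ℝ → ℝ) (t : ℝ), t ∈ Set.Icc 0 T → IntervalIntegrable u volume 0 T →
      ‖∫ s in (0 : ℝ)..t, propagator L (-s) ((∫ r in (0 : ℝ)..s, u r) • L b)‖ ≤
        C * ∫ r in (0 : ℝ)..T, |u r| := by
  obtain ⟨M, hM, hbound⟩ := exists_norm_propagator_le L T
  refine ⟨M * ‖L b‖ * |T|, by positivity, fun u t ht hu => ?_⟩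
  have hI : 0 ≤ ∫ r in (0 : ℝ)..T, |u r| :=
    intervalIntegral.integral_nonneg (ht.1.trans ht.2) fun _ _ => abs_nonneg _
  have h := intervalIntegral.norm_integral_le_of_norm_le_const (a := 0) (b := t)
    (f := fun s => propagator L (-s) ((∫ r in (0 : ℝ)..s, u r) • L b))
    (C := M * ((∫ r in (0 : ℝ)..T, |u r|) * ‖L b‖)) (by
      intro s hs
      rw [Set.uIoc_of_le ht.1] at hs
      have hs' : s ∈ Set.Icc 0 T := ⟨hs.1.le, hs.2.trans ht.2⟩
      refine (ContinuousLinearMap.le_opNorm _ _).trans ?_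
      rw [norm_smul, Real.norm_eq_abs]
      gcongr
      · exact hbound _ (by rw [abs_neg, abs_of_nonneg hs'.1]; exact hs'.2)
      · exact abs_integral_le_of_mem_Icc hs' hu)
  refine h.trans ?_
  rw [sub_zero, abs_of_nonneg ht.1]
  have : t ≤ |T| := ht.2.trans (le_abs_self T)
  calc _ ≤ M * ((∫ r in (0 : ℝ)..T, |u r|) * ‖L b‖) * |T| := by gcongr
    _ = _ := by ring

theorem exists_norm_flow_le (L : E →L[ℝ] E) (b : E) (T : ℝ) :
    ∃ C : ℝ, 0 ≤ C ∧ ∀ (u : ℝ → ℝ) (ξ : E) (t : ℝ), t ∈ Set.Icc 0 T →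
      IntervalIntegrable u volume 0 T →
      ‖flow L b u ξ t‖ ≤ C * (‖ξ‖ + ∫ r in (0 : ℝ)..T, |u r|) := by
  obtain ⟨M, hM, hbound⟩ := exists_norm_propagator_le L T
  obtain ⟨C, hC, hforce⟩ := exists_norm_pulledForcing_le L b (T := T)
  refine ⟨‖b‖ + M * (1 + C), by positivity, fun u ξ t ht hu => ?_⟩
  have hI : 0 ≤ ∫ r in (0 : ℝ)..T, |u r| :=
    intervalIntegral.integral_nonneg (ht.1.trans ht.2) fun _ _ => abs_nonneg _
  set I := ∫ r in (0 : ℝ)..T, |u r|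
  have h1 : ‖(∫ r in (0 : ℝ)..t, u r) • b‖ ≤ I * ‖b‖ := by
    rw [norm_smul, Real.norm_eq_abs]
    gcongr
    exact abs_integral_le_of_mem_Icc ht hu
  have h2 : ‖propagator L t
      (ξ + ∫ s in (0 : ℝ)..t, propagator L (-s) ((∫ r in (0 : ℝ)..s, u r) • L b))‖ ≤
      M * (‖ξ‖ + C * I) := by
    refine (ContinuousLinearMap.le_opNorm _ _).trans ?_
    gcongr
    · exact hbound t (by rw [abs_of_nonneg ht.1]; exact ht.2)
    · exact (norm_add_le _ _).trans (by gcongr; exact hforce u t ht hu)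
  refine (norm_add_le _ _).trans ((add_le_add h1 h2).trans ?_)
  nlinarith [mul_nonneg (norm_nonneg b) (norm_nonneg ξ), mul_nonneg hM.le hI,
    mul_nonneg (mul_nonneg hM.le hC) (norm_nonneg ξ)]

/-- A solution that ends at the origin is controlled by the `L¹` norm of its control. -/
theorem exists_norm_flow_le_of_flow_eq_zero (L : E →L[ℝ] E) (b : E) (T : ℝ) :
    ∃ C : ℝ, 0 ≤ C ∧ ∀ (u : ℝ → ℝ) (ξ : E), IntervalIntegrable u volume 0 T →
      flow L b u ξ T = 0 → ∀ t ∈ Set.Icc 0 T,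
      ‖flow L b u ξ t‖ ≤ C * ∫ r in (0 : ℝ)..T, |u r| := by
  obtain ⟨M, hM, hbound⟩ := exists_norm_propagator_le L |T|
  obtain ⟨C, hC, hforce⟩ := exists_norm_pulledForcing_le L b (T := T)
  obtain ⟨K, hK, hflow⟩ := exists_norm_flow_le L b T
  refine ⟨K * (M * ‖b‖ + C + 1), by positivity, fun u ξ hu h t ht => ?_⟩
  have hT : 0 ≤ T := ht.1.trans ht.2
  have hI : 0 ≤ ∫ r in (0 : ℝ)..T, |u r| :=
    intervalIntegral.integral_nonneg hT fun _ _ => abs_nonneg _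
  have hf := hforce u T ⟨hT, le_rfl⟩ hu
  have hV := abs_integral_le_of_mem_Icc ⟨hT, le_rfl⟩ hu
  have hfl := hflow u ξ t ht hu
  set I := ∫ r in (0 : ℝ)..T, |u r|
  -- The terminal condition is solved backwards for `ξ`. This bounds the initial state by the `L¹`
  -- norm, and the forward estimate `hfl` then needs nothing else.
  have h2 := congrArg (propagator L (-T)) h
  rw [flow, map_add, propagator_neg_apply, map_zero] at h2
  have hξ : ξ = -(propagator L (-T) ((∫ r in (0 : ℝ)..T, u r) • b)) -
      ∫ s in (0 : ℝ)..T, propagator L (-s) ((∫ r in (0 : ℝ)..s, u r) • L b) := by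
    rw [← sub_eq_zero, ← h2]; abel
  have h3 : ‖propagator L (-T) ((∫ r in (0 : ℝ)..T, u r) • b)‖ ≤ M * (I * ‖b‖) := by
    refine (ContinuousLinearMap.le_opNorm _ _).trans ?_
    rw [norm_smul, Real.norm_eq_abs]
    gcongr
    exact hbound _ (abs_neg T).le
  have h4 : ‖ξ‖ ≤ M * (I * ‖b‖) + C * I := by
    rw [hξ]
    exact (norm_sub_le _ _).trans (add_le_add (by rwa [norm_neg]) hf)
  calc _ ≤ K * (‖ξ‖ + I) := hfl
    _ ≤ K * (M * (I * ‖b‖) + C * I + I) := by gcongr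
    _ = _ := by ring

end Flow

/-! ### Trajectories coincide with the flow -/

section Trajectory

variable {n : ℕ} {A : Matrix (Fin n) (Fin n) ℝ} {B : EuclideanSpace ℝ (Fin n)}

theorem IsTrajectory.mono {u : ℝ → ℝ} {S S' : Set ℝ} {x : ℝ → EuclideanSpace ℝ (Fin n)}
    (h : IsTrajectory A B u S x) (hS : S' ⊆ S) : IsTrajectory A B u S' x :=
  ⟨h.1.mono hS, fun t ht => h.2 t (hS ht)⟩

theorem toEuclideanLin_eq_toEuclideanCLM (x : EuclideanSpace ℝ (Fin n)) :
    Matrix.toEuclideanLin A x = Matrix.toEuclideanCLM (𝕜 := ℝ) A x := rfl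

theorem integral_trajectory_eq {u : ℝ → ℝ} {x : ℝ → EuclideanSpace ℝ (Fin n)} {S t : ℝ}
    (ht : t ∈ Set.Icc 0 S) (hu : IntervalIntegrable u volume 0 S)
    (hx : ContinuousOn x (Set.Icc 0 S)) :
    ∫ s in (0 : ℝ)..t, (Matrix.toEuclideanLin A (x s) + u s • B) =
      (∫ s in (0 : ℝ)..t, Matrix.toEuclideanCLM (𝕜 := ℝ) A (x s)) +
        (∫ s in (0 : ℝ)..t, u s) • B := by
  have hsub : Set.uIcc 0 t ⊆ Set.uIcc 0 S := by
    rw [Set.uIcc_of_le ht.1, Set.uIcc_of_le (ht.1.trans ht.2)]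
    exact Set.Icc_subset_Icc_right ht.2
  simp only [toEuclideanLin_eq_toEuclideanCLM]
  rw [intervalIntegral.integral_add, intervalIntegral.integral_smul_const]
  · exact intervalIntegrable_of_continuousOn_Icc
      ((ContinuousLinearMap.continuous _).comp_continuousOn hx) ht
  · have h := (hu.mono_set hsub)
    exact ⟨h.1.smul_const B, h.2.smul_const B⟩

theorem isTrajectory_flow {u : ℝ → ℝ} {S : ℝ} (hS : 0 ≤ S) (hu : IntervalIntegrable u volume 0 S)
    (ξ : EuclideanSpace ℝ (Fin n)) :
    IsTrajectory A B u (Set.Icc 0 S) (flow (Matrix.toEuclideanCLM (𝕜 := ℝ) A) B u ξ) := by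
  set L := Matrix.toEuclideanCLM (𝕜 := ℝ) A with hL
  obtain ⟨hy, hint⟩ := integral_eq_of_eq_propagator (L := L) (ξ := ξ)
    (y := fun t => flow L B u ξ t - (∫ r in (0 : ℝ)..t, u r) • B)
    (continuousOn_forcing L B hS hu) (fun t _ => by simp [flow])
  have hV := continuousOn_integral hS hu
  have hx : ContinuousOn (flow L B u ξ) (Set.Icc 0 S) := by
    refine (hy.add (hV.smul (continuousOn_const (c := B)))).congr fun t _ => ?_
    simp
  refine ⟨hx, fun t ht => ⟨?_, ?_⟩⟩
  · refine hu.mono_set ?_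
    rw [Set.uIcc_of_le ht.1, Set.uIcc_of_le hS]
    exact Set.Icc_subset_Icc_right ht.2
  · rw [integral_trajectory_eq ht hu hx, flow_zero_time]
    have := hint t ht
    simp only [map_sub, map_smul, sub_add_cancel] at this
    rw [← add_assoc, ← this, sub_add_cancel]

theorem IsTrajectory.eq_flow {u : ℝ → ℝ} {S : ℝ} {x : ℝ → EuclideanSpace ℝ (Fin n)}
    (h : IsTrajectory A B u (Set.Icc 0 S) x) {t : ℝ} (ht : t ∈ Set.Icc 0 S) :
    x t = flow (Matrix.toEuclideanCLM (𝕜 := ℝ) A) B u (x 0) t := by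
  set L := Matrix.toEuclideanCLM (𝕜 := ℝ) A with hL
  have hS : 0 ≤ S := ht.1.trans ht.2
  have hu := (h.2 S ⟨hS, le_rfl⟩).1
  have hV := continuousOn_integral hS hu
  -- With `V` the primitive of `u`, the difference `x - V • B` solves an equation whose forcing `V •
  -- L B` is continuous, although `u` is only integrable.
  have key := eq_propagator_of_integral_eq (L := L)
    (f := fun s => (∫ r in (0 : ℝ)..s, u r) • L B)
    (y := fun t => x t - (∫ r in (0 : ℝ)..t, u r) • B) (continuousOn_forcing L B hS hu)
    (h.1.sub (hV.smul continuousOn_const)) (by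
      intro r hr
      have := (h.2 r hr).2
      rw [integral_trajectory_eq hr hu h.1] at this
      simp only [map_sub, map_smul, sub_add_cancel, intervalIntegral.integral_same, zero_smul,
        sub_zero]
      rw [this]
      abel) ht
  simp only [intervalIntegral.integral_same, zero_smul, sub_zero] at key
  rw [flow, ← key]
  abel

theorem IsTrajectory.comp_add {u : ℝ → ℝ} {x : ℝ → EuclideanSpace ℝ (Fin n)} {a S : ℝ}
    (ha : 0 ≤ a) (h : IsTrajectory A B u (Set.Icc 0 (a + S)) x) :
    IsTrajectory A B (fun s => u (a + s)) (Set.Icc 0 S) (fun s => x (a + s)) := by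
  have hmaps : ∀ t ∈ Set.Icc 0 S, a + t ∈ Set.Icc 0 (a + S) := fun t ht =>
    ⟨add_nonneg ha ht.1, by linarith [ht.2]⟩
  refine ⟨h.1.comp (by fun_prop) hmaps, fun t ht => ?_⟩
  have hat := h.2 _ (hmaps t ht)
  have ha' := h.2 a ⟨ha, by linarith [ht.1, ht.2]⟩
  have hu : IntervalIntegrable u volume a (a + t) := ha'.1.symm.trans hat.1
  refine ⟨by simpa using hu.comp_add_left a, ?_⟩
  have hint : ∀ r ∈ Set.Icc 0 (a + S), IntervalIntegrable
      (fun s => Matrix.toEuclideanLin A (x s) + u s • B) volume 0 r := by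
    intro r hr
    have hur := (h.2 r hr).1
    refine IntervalIntegrable.add ?_ ⟨hur.1.smul_const B, hur.2.smul_const B⟩
    exact intervalIntegrable_of_continuousOn_Icc
      ((Matrix.toEuclideanCLM (𝕜 := ℝ) A).continuous.comp_continuousOn h.1) hr
  have hshift := intervalIntegral.integral_comp_add_left
    (fun s => Matrix.toEuclideanLin A (x s) + u s • B) a (a := 0) (b := t)
  change x (a + t) = x (a + 0) + _
  rw [hshift, add_zero, hat.2, ← intervalIntegral.integral_add_adjacent_intervals (hint a ⟨ha, by
    linarith [ht.1, ht.2]⟩) ((hint a ⟨ha, by linarith [ht.1, ht.2]⟩).symm.trans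
    (hint _ (hmaps t ht)))]
  rw [← add_assoc, ← ha'.2]

/-- The system is autonomous: a time-shifted trajectory solves it with the shifted control, and
uniqueness identifies it with the flow. -/
theorem flow_add {u : ℝ → ℝ} {a t : ℝ} (ha : 0 ≤ a) (ht : 0 ≤ t)
    (hu : IntervalIntegrable u volume 0 (a + t)) (ξ : EuclideanSpace ℝ (Fin n)) :
    flow (Matrix.toEuclideanCLM (𝕜 := ℝ) A) B u ξ (a + t) =
      flow (Matrix.toEuclideanCLM (𝕜 := ℝ) A) B (fun s => u (a + s))
        (flow (Matrix.toEuclideanCLM (𝕜 := ℝ) A) B u ξ a) t := by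
  have := ((isTrajectory_flow (A := A) (B := B) (add_nonneg ha ht) hu ξ).comp_add ha).eq_flow
    ⟨ht, le_rfl⟩
  simpa using this

theorem flow_zero_of_ae_eq_zero {L : EuclideanSpace ℝ (Fin n) →L[ℝ] EuclideanSpace ℝ (Fin n)}
    {u : ℝ → ℝ} {t : ℝ} (ht : 0 ≤ t)
    (h : ∀ᵐ s, s ∈ Set.Ioc 0 t → u s = 0) : flow L B u 0 t = 0 := by
  rw [flow_congr (v := fun _ => 0) ht h]
  simp [flow]

end Trajectory

/-! ### Feasibility as a terminal equation for the flow -/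

section Feasibility

variable {n : ℕ} {A : Matrix (Fin n) (Fin n) ℝ} {B : EuclideanSpace ℝ (Fin n)}

theorem intervalIntegrable_of_ae_abs_le {u : ℝ → ℝ} {T C : ℝ} (hT : 0 ≤ T)
    (hm : AEMeasurable u (volume.restrict (Set.Icc 0 T)))
    (hb : ∀ᵐ s ∂(volume.restrict (Set.Icc 0 T)), |u s| ≤ C) :
    IntervalIntegrable u volume 0 T := by
  rw [intervalIntegrable_iff_integrableOn_Icc_of_le hT]
  exact Integrable.of_bound hm.aestronglyMeasurable C hb

theorem isFeasible_iff {T : ℝ} (hT : 0 ≤ T) {ξ : EuclideanSpace ℝ (Fin n)} {u : ℝ → ℝ} :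
    IsFeasible A B T ξ u ↔ AEMeasurable u (volume.restrict (Set.Icc 0 T)) ∧
      (∀ᵐ s ∂(volume.restrict (Set.Icc 0 T)), |u s| ≤ 1) ∧
      flow (Matrix.toEuclideanCLM (𝕜 := ℝ) A) B u ξ T = 0 := by
  refine and_congr_right fun hm => and_congr_right fun hb => ⟨?_, fun h => ?_⟩
  · rintro ⟨x, hx, h0, hxT⟩
    rw [← h0, ← hx.eq_flow ⟨hT, le_rfl⟩, hxT]
  · exact ⟨_, isTrajectory_flow hT (intervalIntegrable_of_ae_abs_le hT hm hb) ξ,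
      flow_zero_time _ _ _ _, h⟩

theorem IsFeasible.intervalIntegrable {T : ℝ} (hT : 0 ≤ T) {ξ : EuclideanSpace ℝ (Fin n)}
    {u : ℝ → ℝ} (h : IsFeasible A B T ξ u) : IntervalIntegrable u volume 0 T :=
  intervalIntegrable_of_ae_abs_le hT h.1 h.2.1

end Feasibility

/-! ### Steering to the origin with the controllability Gramian -/

section Controllability

/-- Integration by parts removes the primitive of `u` and recovers the usual Duhamel formula. -/
theorem flow_of_continuous {E : Type*} [NormedAddCommGroup E] [NormedSpace ℝ E] [CompleteSpace E]
    (L : E →L[ℝ] E) (b : E) {u : ℝ → ℝ} (hu : Continuous u) (ξ : E) (t : ℝ) :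
    flow L b u ξ t = propagator L t (ξ + ∫ s in (0 : ℝ)..t, u s • propagator L (-s) b) := by
  set V : ℝ → ℝ := fun s => ∫ r in (0 : ℝ)..s, u r with hV
  have hVd : ∀ s, HasDerivAt V (u s) s := fun s => hu.integral_hasStrictDerivAt 0 s |>.hasDerivAt
  have hVc : Continuous V := continuous_iff_continuousAt.2 fun s => (hVd s).continuousAt
  have hd : ∀ s, HasDerivAt (fun s => propagator L (-s) (V s • b))
      (u s • propagator L (-s) b - propagator L (-s) (V s • L b)) s := by
    intro s
    have := (hasDerivAt_propagator_neg L s).clm_apply ((hVd s).smul_const b)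
    convert this using 1
    simp
    abel
  have hc1 : Continuous fun s => u s • propagator L (-s) b :=
    hu.smul ((continuous_propagator_neg L).clm_apply continuous_const)
  have hc2 : Continuous fun s => propagator L (-s) (V s • L b) :=
    (continuous_propagator_neg L).clm_apply (hVc.smul continuous_const)
  have key := intervalIntegral.integral_eq_sub_of_hasDerivAt (a := 0) (b := t)
    (fun s _ => hd s) ((hc1.sub hc2).intervalIntegrable _ _)
  rw [intervalIntegral.integral_sub (hc1.intervalIntegrable _ _)
    (hc2.intervalIntegrable _ _)] at key
  have hV0 : V 0 = 0 := by simp [hV]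
  rw [hV0, zero_smul, map_zero, sub_zero, sub_eq_iff_eq_add] at key
  rw [key, flow, map_add, map_add, map_add, propagator_apply_neg]
  abel

variable {n : ℕ} {A : Matrix (Fin n) (Fin n) ℝ} {B : EuclideanSpace ℝ (Fin n)}

theorem analyticOnNhd_inner_propagator_neg {E : Type*} [NormedAddCommGroup E]
    [InnerProductSpace ℝ E] [CompleteSpace E] (L : E →L[ℝ] E) (b p : E) :
    AnalyticOnNhd ℝ (fun s : ℝ => inner ℝ p (propagator L (-s) b)) Set.univ := by
  intro s _
  have h1 : AnalyticAt ℝ (fun s : ℝ => propagator L (-s)) s := by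
    refine AnalyticAt.fun_comp (g := NormedSpace.exp) (f := fun s : ℝ => (-s) • L)
      (NormedSpace.exp_analytic _) ?_
    exact (analyticAt_id.neg).smul analyticAt_const
  have h2 := ((innerSL ℝ p).comp (ContinuousLinearMap.apply ℝ E b)).analyticAt
    (propagator L (-s))
  exact AnalyticAt.fun_comp (f := fun s : ℝ => propagator L (-s)) h2 h1

/-- For a controllable pair no nonzero functional annihilates `exp (-s A) B` on an interval. -/
theorem eq_zero_of_inner_propagator_neg_eq_zero (hAB : IsControllable A B) {T : ℝ} (hT : 0 < T)
    {p : EuclideanSpace ℝ (Fin n)}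
    (hp : ∀ s ∈ Set.Icc 0 T,
      inner ℝ p (propagator (Matrix.toEuclideanCLM (𝕜 := ℝ) A) (-s) B) = 0) : p = 0 := by
  set L := Matrix.toEuclideanCLM (𝕜 := ℝ) A with hL
  -- Analyticity extends the vanishing to all times. This is needed because the steering time `S`
  -- given by controllability is unrelated to `T`.
  have hg : (fun s : ℝ => inner ℝ p (propagator L (-s) B)) = fun _ => (0 : ℝ) := by
    refine (analyticOnNhd_inner_propagator_neg L B p).eq_of_eventuallyEq (z₀ := T / 2)
      (fun _ _ => analyticAt_const) ?_
    filter_upwards [Icc_mem_nhds (show 0 < T / 2 by linarith) (show T / 2 < T by linarith)]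
      with s hs using hp s hs
  have hg' : ∀ s, inner ℝ p (propagator L (-s) (L B)) = 0 := by
    intro s
    have h1 := ((innerSL ℝ p).hasFDerivAt.comp_hasDerivAt s
      ((hasDerivAt_propagator_neg L s).clm_apply (hasDerivAt_const s B)))
    have h2 : (⇑(innerSL ℝ p) ∘ fun s => propagator L (-s) B) = fun _ => (0 : ℝ) := hg
    rw [h2] at h1
    simpa using h1.unique (hasDerivAt_const s (0 : ℝ))
  -- Steer `p` itself to the origin, pull the terminal equation back to time zero and pair it with
  -- `p`: every control term vanishes, leaving `⟪p, p⟫ = 0`.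
  obtain ⟨S, hS, u, x, hx, h0, hxS⟩ := hAB p 0
  have hend := hx.eq_flow ⟨hS.le, le_rfl⟩
  rw [hxS, h0, flow] at hend
  have h2 := congrArg (propagator L (-S)) hend
  rw [map_zero, map_add, propagator_neg_apply] at h2
  have h3 := congrArg (inner ℝ p) h2
  have hu := (hx.2 S ⟨hS.le, le_rfl⟩).1
  have hint : inner ℝ p (∫ s in (0 : ℝ)..S, propagator L (-s) ((∫ r in (0 : ℝ)..s, u r) • L B))
      = 0 := by
    have := (innerSL ℝ p).intervalIntegral_comp_comm (intervalIntegrable_of_continuousOn_Icc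
      (continuousOn_pulledForcing L B hS.le hu) ⟨hS.le, le_rfl⟩)
    simp only [innerSL_apply_apply] at this
    rw [← this]
    simp [inner_smul_right, hg']
  rw [inner_zero_right, inner_add_right, inner_add_right, hint, map_smul, inner_smul_right,
    congrFun hg S] at h3
  simpa using h3.symm

/-- A controllable system can be steered to the origin in any time by a continuous control whose
size is linear in the initial state. -/
theorem exists_continuous_control (hAB : IsControllable A B) {T : ℝ} (hT : 0 < T) :
    ∃ c : ℝ, 0 ≤ c ∧ ∀ ξ : EuclideanSpace ℝ (Fin n), ∃ u : ℝ → ℝ, Continuous u ∧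
      flow (Matrix.toEuclideanCLM (𝕜 := ℝ) A) B u ξ T = 0 ∧
      ∀ s ∈ Set.Icc 0 T, |u s| ≤ c * ‖ξ‖ := by
  set L := Matrix.toEuclideanCLM (𝕜 := ℝ) A with hL
  have hk : Continuous fun s => propagator L (-s) B :=
    (continuous_propagator_neg L).clm_apply continuous_const
  have hc : ∀ p : EuclideanSpace ℝ (Fin n),
      Continuous fun s => inner ℝ p (propagator L (-s) B) := fun p => continuous_const.inner hk
  have hcc : ∀ p : EuclideanSpace ℝ (Fin n), Continuous fun s =>
      inner ℝ p (propagator L (-s) B) • propagator L (-s) B := fun p => (hc p).smul hk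
  -- The controllability Gramian. It is injective because `⟪p, W p⟫` is the integral of the square
  -- of `⟪p, exp (-s L) B⟫`. The control sought is `-⟪W⁻¹ ξ, exp (-s L) B⟫`, which is linear in `ξ`.
  let W : EuclideanSpace ℝ (Fin n) →ₗ[ℝ] EuclideanSpace ℝ (Fin n) :=
    { toFun := fun p => ∫ s in (0 : ℝ)..T, inner ℝ p (propagator L (-s) B) • propagator L (-s) B
      map_add' := fun p q => by
        rw [← intervalIntegral.integral_add ((hcc p).intervalIntegrable _ _)
          ((hcc q).intervalIntegrable _ _)]
        simp only [inner_add_left, add_smul]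
      map_smul' := fun r p => by
        rw [RingHom.id_apply, ← intervalIntegral.integral_smul]
        simp only [real_inner_smul_left, mul_smul] }
  have hW : ∀ p, W p =
      ∫ s in (0 : ℝ)..T, inner ℝ p (propagator L (-s) B) • propagator L (-s) B := fun _ => rfl
  have hinj : Function.Injective W := by
    rw [← LinearMap.ker_eq_bot, LinearMap.ker_eq_bot']
    intro p hp
    have h1 : ∫ s in (0 : ℝ)..T, (inner ℝ p (propagator L (-s) B)) ^ 2 = (0 : ℝ) := by
      have := (innerSL ℝ p).intervalIntegral_comp_comm
        ((hcc p).intervalIntegrable (μ := volume) 0 T)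
      rw [← hW p, hp, map_zero] at this
      simpa [inner_smul_right, sq] using this
    refine eq_zero_of_inner_propagator_neg_eq_zero hAB hT fun s hs => ?_
    by_contra hne
    have : 0 < ∫ s in (0 : ℝ)..T, (inner ℝ p (propagator L (-s) B)) ^ 2 :=
      intervalIntegral.integral_pos hT ((hc p).pow 2).continuousOn (fun _ _ => sq_nonneg _)
        ⟨s, hs, by positivity⟩
    exact this.ne' h1
  let e := LinearEquiv.ofInjectiveEndo W hinj
  have he : ∀ ξ, W (e.symm ξ) = ξ := fun ξ => e.apply_symm_apply ξ
  let R := LinearMap.toContinuousLinearMap e.symm.toLinearMap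
  obtain ⟨M, hM, hbound⟩ := exists_norm_propagator_le L T
  refine ⟨‖R‖ * (M * ‖B‖), by positivity, fun ξ =>
    ⟨fun s => -inner ℝ (R ξ) (propagator L (-s) B), (hc _).neg, ?_, fun s hs => ?_⟩⟩
  · rw [flow_of_continuous L B (u := fun s => -inner ℝ (R ξ) (propagator L (-s) B)) (hc _).neg]
    simp only [neg_smul, intervalIntegral.integral_neg]
    rw [← hW]
    have : W (R ξ) = ξ := he ξ
    rw [this, add_neg_cancel, map_zero]
  · rw [abs_neg]
    calc _ ≤ ‖R ξ‖ * ‖propagator L (-s) B‖ := abs_real_inner_le_norm _ _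
      _ ≤ (‖R‖ * ‖ξ‖) * (M * ‖B‖) := by
        gcongr
        · exact R.le_opNorm ξ
        · refine (ContinuousLinearMap.le_opNorm _ _).trans ?_
          gcongr
          exact hbound _ (by rw [abs_neg, abs_of_nonneg hs.1]; exact hs.2)
      _ = _ := by ring

end Controllability

/-! ### Convex minimization in Hilbert space -/

section HilbertMinimization

variable {H : Type*} [NormedAddCommGroup H] [InnerProductSpace ℝ H]

/-- The midpoint of `p` and `q` lies in `C`, so its norm is at least `‖p‖`; the parallelogram law
does the rest. -/
theorem norm_sub_sq_le_of_norm_minimal {C : Set H} (hconv : Convex ℝ C) {p q : H} (hp : p ∈ C)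
    (hq : q ∈ C) (hmin : ∀ r ∈ C, ‖p‖ ≤ ‖r‖) : ‖p - q‖ ^ 2 ≤ 2 * (‖q‖ ^ 2 - ‖p‖ ^ 2) := by
  have hmid : (1 / 2 : ℝ) • p + (1 / 2 : ℝ) • q ∈ C :=
    hconv hp hq (by norm_num) (by norm_num) (by norm_num)
  have h1 := hmin _ hmid
  rw [← smul_add, norm_smul, Real.norm_of_nonneg (by norm_num)] at h1
  have h2 := parallelogram_law_with_norm ℝ p q
  have h3 : (2 * ‖p‖) * (2 * ‖p‖) ≤ ‖p + q‖ * ‖p + q‖ :=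
    mul_self_le_mul_self (by positivity) (by linarith)
  nlinarith

variable [CompleteSpace H]

theorem exists_norm_minimal_of_convex {C : Set H} (hc : IsClosed C) (hconv : Convex ℝ C)
    (hne : C.Nonempty) : ∃ p ∈ C, ∀ q ∈ C, ‖p‖ ≤ ‖q‖ := by
  obtain ⟨p, hp, hmin⟩ := exists_norm_eq_iInf_of_complete_convex hne hc.isComplete hconv 0
  refine ⟨p, hp, fun q hq => ?_⟩
  simp only [zero_sub, norm_neg] at hmin
  rw [hmin]
  exact ciInf_le ⟨0, by rintro _ ⟨w, rfl⟩; exact norm_nonneg _⟩ (⟨q, hq⟩ : C)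

/-- A decreasing sequence of nonempty closed convex sets, the first of which is bounded, has a
common point. -/
theorem nonempty_iInter_of_convex {C : ℕ → Set H} (hanti : Antitone C)
    (hc : ∀ k, IsClosed (C k)) (hconv : ∀ k, Convex ℝ (C k)) (hne : ∀ k, (C k).Nonempty)
    (hb : Bornology.IsBounded (C 0)) : (⋂ k, C k).Nonempty := by
  -- The points of least norm have increasing, bounded norms, so the preceding estimate makes them a
  -- Cauchy sequence. Its limit lies in every `C k`.
  choose p hp hmin using fun k => exists_norm_minimal_of_convex (hc k) (hconv k) (hne k)
  have hmono : Monotone fun k => ‖p k‖ ^ 2 := fun i j hij =>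
    pow_le_pow_left₀ (norm_nonneg _) (hmin i _ (hanti hij (hp j))) 2
  obtain ⟨R, hR⟩ := hb.exists_norm_le
  have hbdd : BddAbove (Set.range fun k => ‖p k‖ ^ 2) := by
    refine ⟨R ^ 2, ?_⟩
    rintro _ ⟨k, rfl⟩
    exact pow_le_pow_left₀ (norm_nonneg _) (hR _ (hanti (Nat.zero_le k) (hp k))) 2
  have hlim := tendsto_atTop_ciSup hmono hbdd
  set l := ⨆ k, ‖p k‖ ^ 2
  have hdist : ∀ N i j, N ≤ i → i ≤ j → dist (p i) (p j) ≤ √(2 * (l - ‖p N‖ ^ 2)) := by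
    intro N i j hi hij
    rw [dist_eq_norm]
    refine Real.le_sqrt_of_sq_le ?_
    refine (norm_sub_sq_le_of_norm_minimal (hconv i) (hp i) (hanti hij (hp j)) (hmin i)).trans ?_
    have h1 : ‖p N‖ ^ 2 ≤ ‖p i‖ ^ 2 := hmono hi
    have h2 : ‖p j‖ ^ 2 ≤ l := le_ciSup hbdd j
    linarith
  have hcauchy : CauchySeq p := by
    refine cauchySeq_of_le_tendsto_0 (fun N => √(2 * (l - ‖p N‖ ^ 2))) ?_ ?_
    · intro i j N hi hj
      rcases le_total i j with h | h
      · exact hdist N i j hi h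
      · rw [dist_comm]; exact hdist N j i hj h
    · have := ((hlim.const_sub l).const_mul 2).sqrt
      simpa using this
  obtain ⟨q, hq⟩ := cauchySeq_tendsto_of_complete hcauchy
  refine ⟨q, Set.mem_iInter.2 fun k => (hc k).mem_of_tendsto hq ?_⟩
  filter_upwards [Filter.eventually_ge_atTop k] with j hj using hanti hj (hp j)

/-- The sublevel sets at the levels `inf f + 1 / (k + 1)` are nested, nonempty, closed, convex and
bounded. A common point is a minimizer; no weak topology is involved. -/
theorem exists_isMinOn_of_convexOn {K : Set H} {f : H → ℝ} (hK : IsClosed K) (hne : K.Nonempty)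
    (hb : Bornology.IsBounded K) (hf : Continuous f) (hconv : ConvexOn ℝ K f)
    (hbelow : BddBelow (f '' K)) : ∃ p ∈ K, ∀ q ∈ K, f p ≤ f q := by
  set m := sInf (f '' K) with hm
  have key := nonempty_iInter_of_convex (C := fun k : ℕ => {x ∈ K | f x ≤ m + 1 / ((k : ℝ) + 1)})
    (fun i j hij x hx => ⟨hx.1, hx.2.trans (by
      have := Nat.one_div_le_one_div (α := ℝ) hij
      linarith)⟩)
    (fun k => hK.inter (isClosed_le hf continuous_const))
    (fun k => hconv.convex_le _)
    (fun k => by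
      obtain ⟨_, ⟨x, hx, rfl⟩, hlt⟩ := exists_lt_of_csInf_lt (hne.image f)
        (show sInf (f '' K) < m + 1 / ((k : ℝ) + 1) from
          lt_add_of_pos_right _ Nat.one_div_pos_of_nat)
      exact ⟨x, hx, hlt.le⟩)
    (hb.subset fun x hx => hx.1)
  obtain ⟨p, hp⟩ := key
  rw [Set.mem_iInter] at hp
  refine ⟨p, (hp 0).1, fun q hq => ?_⟩
  have h1 : f p ≤ m := by
    have := tendsto_one_div_add_atTop_nhds_zero_nat (𝕜 := ℝ)
    refine ge_of_tendsto' (by simpa using this.const_add m) fun k => (hp k).2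
  exact h1.trans (csInf_le hbelow ⟨q, hq, rfl⟩)

end HilbertMinimization

/-! ### The cost compared with the `L¹` norm -/

section Cost

/-- The running cost `∑ w_i (|v - U_i| + |v + U_i|)`. -/
noncomputable def stageCost (N : ℕ) (U w : ℕ → ℝ) (v : ℝ) : ℝ :=
  ∑ i ∈ Finset.Icc 1 N, w i * (|v - U i| + |v + U i|)

variable {N : ℕ} {U w : ℕ → ℝ}

theorem continuous_stageCost : Continuous (stageCost N U w) := by
  unfold stageCost
  fun_prop

theorem convexOn_stageCost (hw : ∀ i ∈ Finset.Icc 1 N, 0 ≤ w i) :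
    ConvexOn ℝ Set.univ (stageCost N U w) := by
  refine ⟨convex_univ, fun x _ y _ a b ha hb hab => ?_⟩
  simp only [stageCost, smul_eq_mul, Finset.mul_sum]
  rw [← Finset.sum_add_distrib]
  refine Finset.sum_le_sum fun i hi => ?_
  have hb' : b = 1 - a := by linarith
  have h1 : |a * x + b * y - U i| ≤ a * |x - U i| + b * |y - U i| := by
    rw [show a * x + b * y - U i = a * (x - U i) + b * (y - U i) by rw [hb']; ring]
    refine (abs_add_le _ _).trans_eq ?_
    rw [abs_mul, abs_mul, abs_of_nonneg ha, abs_of_nonneg hb]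
  have h2 : |a * x + b * y + U i| ≤ a * |x + U i| + b * |y + U i| := by
    rw [show a * x + b * y + U i = a * (x + U i) + b * (y + U i) by rw [hb']; ring]
    refine (abs_add_le _ _).trans_eq ?_
    rw [abs_mul, abs_mul, abs_of_nonneg ha, abs_of_nonneg hb]
  nlinarith [mul_le_mul_of_nonneg_left (add_le_add h1 h2) (hw i hi)]

theorem stageCost_nonneg (hw : ∀ i ∈ Finset.Icc 1 N, 0 ≤ w i) (v : ℝ) :
    0 ≤ stageCost N U w v :=
  Finset.sum_nonneg fun i hi => mul_nonneg (hw i hi) (by positivity)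

theorem stageCost_sub_le (hw : ∀ i ∈ Finset.Icc 1 N, 0 ≤ w i)
    (hsum : ∑ i ∈ Finset.Icc 1 N, w i = 1) (v v' : ℝ) :
    stageCost N U w v - stageCost N U w v' ≤ 2 * |v - v'| := by
  have : 2 * |v - v'| = ∑ i ∈ Finset.Icc 1 N, w i * (2 * |v - v'|) := by
    rw [← Finset.sum_mul, hsum, one_mul]
  rw [this, stageCost, stageCost, ← Finset.sum_sub_distrib]
  refine Finset.sum_le_sum fun i hi => ?_
  rw [← mul_sub]
  refine mul_le_mul_of_nonneg_left ?_ (hw i hi)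
  have h1 := abs_sub_abs_le_abs_sub (v - U i) (v' - U i)
  have h2 := abs_sub_abs_le_abs_sub (v + U i) (v' + U i)
  rw [sub_sub_sub_cancel_right] at h1
  rw [add_sub_add_right_eq_sub] at h2
  linarith

/-- The term `i = 1` equals `2 * w 1 * |v|` because `U 1 = 0`. Each other term is least at zero,
since `|v - U i| + |v + U i| ≥ 2 * |U i|`. -/
theorem stageCost_zero_add_le (hU : U 1 = 0) (hN : 1 ≤ N)
    (hw : ∀ i ∈ Finset.Icc 1 N, 0 ≤ w i) (v : ℝ) :
    stageCost N U w 0 + 2 * w 1 * |v| ≤ stageCost N U w v := by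
  have h1 : 1 ∈ Finset.Icc 1 N := Finset.mem_Icc.2 ⟨le_rfl, hN⟩
  rw [stageCost, stageCost, ← Finset.add_sum_erase _ _ h1, ← Finset.add_sum_erase _ _ h1, hU]
  have : ∑ i ∈ (Finset.Icc 1 N).erase 1, w i * (|0 - U i| + |0 + U i|) ≤
      ∑ i ∈ (Finset.Icc 1 N).erase 1, w i * (|v - U i| + |v + U i|) := by
    refine Finset.sum_le_sum fun i hi =>
      mul_le_mul_of_nonneg_left ?_ (hw i (Finset.mem_of_mem_erase hi))
    rw [zero_sub, zero_add, abs_neg]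
    have := abs_sub (v + U i) (v - U i)
    rw [show v + U i - (v - U i) = 2 * U i by ring, abs_mul, abs_two] at this
    linarith
  simp only [sub_zero, add_zero, abs_zero, mul_zero, zero_add] at this ⊢
  linarith

theorem intervalIntegrable_stageCost (hw : ∀ i ∈ Finset.Icc 1 N, 0 ≤ w i)
    (hsum : ∑ i ∈ Finset.Icc 1 N, w i = 1) {u : ℝ → ℝ} {a b : ℝ}
    (hu : IntervalIntegrable u volume a b) :
    IntervalIntegrable (fun s => stageCost N U w (u s)) volume a b := by
  refine IntervalIntegrable.mono_fun' (g := fun s => stageCost N U w 0 + 2 * |u s|)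
    (intervalIntegrable_const.add (hu.abs.const_mul 2)) ?_ ?_
  · exact continuous_stageCost.comp_aestronglyMeasurable (intervalIntegrable_iff.1 hu).aestronglyMeasurable
  · refine Filter.Eventually.of_forall fun s => ?_
    have := stageCost_sub_le (U := U) hw hsum (u s) 0
    rw [sub_zero] at this
    simp only [Real.norm_eq_abs, abs_of_nonneg (stageCost_nonneg hw (u s))]
    linarith

theorem soavCost_eq {T : ℝ} {u : ℝ → ℝ} (hu : IntervalIntegrable u volume 0 T) :
    soavCost N U w T u = ∫ s in (0 : ℝ)..T, stageCost N U w (u s) := by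
  have h1 : ∀ i, IntervalIntegrable (fun s => |u s - U i|) volume 0 T := fun i =>
    (hu.sub intervalIntegrable_const).abs
  have h2 : ∀ i, IntervalIntegrable (fun s => |u s + U i|) volume 0 T := fun i =>
    (hu.add intervalIntegrable_const).abs
  simp only [soavCost, stageCost]
  rw [intervalIntegral.integral_finsetSum fun i _ => ((h1 i).add (h2 i)).const_mul (w i)]
  refine Finset.sum_congr rfl fun i _ => ?_
  rw [intervalIntegral.integral_const_mul, intervalIntegral.integral_add (h1 i) (h2 i)]

theorem soavCost_sub_le (hw : ∀ i ∈ Finset.Icc 1 N, 0 ≤ w i)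
    (hsum : ∑ i ∈ Finset.Icc 1 N, w i = 1) {T : ℝ} (hT : 0 ≤ T) {u v : ℝ → ℝ}
    (hu : IntervalIntegrable u volume 0 T) (hv : IntervalIntegrable v volume 0 T) :
    soavCost N U w T u - soavCost N U w T v ≤ 2 * ∫ s in (0 : ℝ)..T, |u s - v s| := by
  rw [soavCost_eq hu, soavCost_eq hv, ← intervalIntegral.integral_sub
    (intervalIntegrable_stageCost hw hsum hu) (intervalIntegrable_stageCost hw hsum hv),
    ← intervalIntegral.integral_const_mul]
  exact intervalIntegral.integral_mono_on hT ((intervalIntegrable_stageCost hw hsum hu).sub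
    (intervalIntegrable_stageCost hw hsum hv)) ((hu.sub hv).abs.const_mul 2)
    fun s _ => stageCost_sub_le hw hsum _ _

theorem soavCost_le (hw : ∀ i ∈ Finset.Icc 1 N, 0 ≤ w i)
    (hsum : ∑ i ∈ Finset.Icc 1 N, w i = 1) {T : ℝ} (hT : 0 ≤ T) {u : ℝ → ℝ}
    (hu : IntervalIntegrable u volume 0 T) :
    soavCost N U w T u ≤ T * stageCost N U w 0 + 2 * ∫ s in (0 : ℝ)..T, |u s| := by
  have h := soavCost_sub_le (U := U) hw hsum hT hu (v := fun _ => 0) intervalIntegrable_const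
  rw [soavCost_eq (u := fun _ => 0) intervalIntegrable_const] at h
  simp only [intervalIntegral.integral_const, sub_zero, smul_eq_mul] at h
  linarith

theorem le_soavCost (hU : U 1 = 0) (hN : 1 ≤ N) (hw : ∀ i ∈ Finset.Icc 1 N, 0 ≤ w i)
    (hsum : ∑ i ∈ Finset.Icc 1 N, w i = 1) {T : ℝ} (hT : 0 ≤ T) {u : ℝ → ℝ}
    (hu : IntervalIntegrable u volume 0 T) :
    T * stageCost N U w 0 + 2 * w 1 * (∫ s in (0 : ℝ)..T, |u s|) ≤ soavCost N U w T u := by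
  rw [soavCost_eq hu]
  have h := intervalIntegral.integral_mono_on hT
    (intervalIntegrable_const.add (hu.abs.const_mul (2 * w 1)))
    (intervalIntegrable_stageCost hw hsum hu)
    fun s _ => stageCost_zero_add_le hU hN hw (u s)
  rw [intervalIntegral.integral_add intervalIntegrable_const (hu.abs.const_mul (2 * w 1)),
    intervalIntegral.integral_const_mul] at h
  simpa using h

theorem soavCost_convex (hw : ∀ i ∈ Finset.Icc 1 N, 0 ≤ w i)
    (hsum : ∑ i ∈ Finset.Icc 1 N, w i = 1) {T : ℝ} (hT : 0 ≤ T) {u v : ℝ → ℝ}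
    (hu : IntervalIntegrable u volume 0 T) (hv : IntervalIntegrable v volume 0 T) {a b : ℝ}
    (ha : 0 ≤ a) (hb : 0 ≤ b) (hab : a + b = 1) :
    soavCost N U w T (fun s => a * u s + b * v s) ≤
      a * soavCost N U w T u + b * soavCost N U w T v := by
  have huv : IntervalIntegrable (fun s => a * u s + b * v s) volume 0 T :=
    (hu.const_mul a).add (hv.const_mul b)
  have hu' := intervalIntegrable_stageCost (U := U) hw hsum hu
  have hv' := intervalIntegrable_stageCost (U := U) hw hsum hv
  rw [soavCost_eq hu, soavCost_eq hv, soavCost_eq huv, ← intervalIntegral.integral_const_mul,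
    ← intervalIntegral.integral_const_mul,
    ← intervalIntegral.integral_add (hu'.const_mul a) (hv'.const_mul b)]
  exact intervalIntegral.integral_mono_on hT (intervalIntegrable_stageCost hw hsum huv)
    ((hu'.const_mul a).add (hv'.const_mul b))
    fun s _ => (convexOn_stageCost hw).2 trivial trivial ha hb hab

theorem soavCost_congr {T : ℝ} (hT : 0 ≤ T) {u v : ℝ → ℝ}
    (h : ∀ᵐ s, s ∈ Set.Ioc 0 T → u s = v s) : soavCost N U w T u = soavCost N U w T v := by
  unfold soavCost
  refine Finset.sum_congr rfl fun i _ => ?_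
  congr 2 <;> refine intervalIntegral.integral_congr_ae ?_ <;> rw [Set.uIoc_of_le hT] <;>
    filter_upwards [h] with s hs hsT <;> rw [hs hsT]

end Cost

/-! ### Existence of optimal controls -/

section OptimalControl

theorem ae_mem_Ioc_of_ae_restrict_Icc {T : ℝ} {p : ℝ → Prop}
    (h : ∀ᵐ s ∂(volume.restrict (Set.Icc 0 T)), p s) : ∀ᵐ s, s ∈ Set.Ioc 0 T → p s := by
  rw [ae_restrict_iff' measurableSet_Icc] at h
  filter_upwards [h] with s hs hsT using hs ⟨hsT.1.le, hsT.2⟩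

theorem intervalIntegrable_coeFn_Lp {T : ℝ} (hT : 0 ≤ T)
    (g : Lp ℝ 2 (volume.restrict (Set.Icc 0 T))) : IntervalIntegrable g volume 0 T := by
  rw [intervalIntegrable_iff_integrableOn_Icc_of_le hT]
  exact (Lp.memLp g).integrable (by norm_num)

theorem exists_integral_abs_le_norm {T : ℝ} (hT : 0 ≤ T) :
    ∃ C : ℝ, 0 ≤ C ∧ ∀ g : Lp ℝ 2 (volume.restrict (Set.Icc 0 T)),
      ∫ s in (0 : ℝ)..T, |g s| ≤ C * ‖g‖ := by
  refine ⟨((volume.restrict (Set.Icc 0 T)) Set.univ ^ (1 / 2 : ℝ)).toReal,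
    ENNReal.toReal_nonneg, fun g => ?_⟩
  have hg := Lp.memLp g
  have h1 : ∫ s in (0 : ℝ)..T, |g s| =
      (eLpNorm g 1 (volume.restrict (Set.Icc 0 T))).toReal := by
    rw [intervalIntegral.integral_of_le hT, ← integral_Icc_eq_integral_Ioc]
    simp only [← Real.norm_eq_abs]
    rw [integral_norm_eq_lintegral_enorm hg.aestronglyMeasurable, eLpNorm_one_eq_lintegral_enorm]
  have h2 := eLpNorm_le_eLpNorm_mul_rpow_measure_univ (p := 1) (q := 2) (by norm_num)
    hg.aestronglyMeasurable
  rw [h1, Lp.norm_def, mul_comm, ← ENNReal.toReal_mul]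
  refine ENNReal.toReal_mono (ENNReal.mul_ne_top hg.eLpNorm_ne_top ?_) (h2.trans_eq ?_)
  · exact ENNReal.rpow_ne_top_of_nonneg (by norm_num) (measure_ne_top _ _)
  · norm_num

/-- On a bounded interval the `L²` norm dominates the `L¹` norm. Both the terminal state and the
cost are `L¹`-Lipschitz in the control, hence continuous on `L²`. -/
theorem continuous_of_dist_le_integral {X : Type*} [PseudoMetricSpace X] {T : ℝ} (hT : 0 ≤ T)
    {F : Lp ℝ 2 (volume.restrict (Set.Icc 0 T)) → X} {C : ℝ} (hC : 0 ≤ C)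
    (hF : ∀ u v, dist (F u) (F v) ≤ C * ∫ s in (0 : ℝ)..T, |u s - v s|) : Continuous F := by
  obtain ⟨K, hK, hbound⟩ := exists_integral_abs_le_norm hT
  refine (LipschitzWith.of_dist_le_mul (K := (C * K).toNNReal) fun u v => ?_).continuous
  refine (hF u v).trans ?_
  have h1 : ∫ s in (0 : ℝ)..T, |u s - v s| = ∫ s in (0 : ℝ)..T, |(u - v) s| := by
    refine intervalIntegral.integral_congr_ae ?_
    rw [Set.uIoc_of_le hT]
    filter_upwards [ae_mem_Ioc_of_ae_restrict_Icc (Lp.coeFn_sub u v)] with s hs hsT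
    rw [hs hsT, Pi.sub_apply]
  rw [h1, dist_eq_norm, Real.coe_toNNReal _ (mul_nonneg hC hK), mul_assoc]
  exact mul_le_mul_of_nonneg_left (hbound _) hC

theorem Lp_linear_combination_ae {T : ℝ} (u v : Lp ℝ 2 (volume.restrict (Set.Icc 0 T)))
    (a b : ℝ) : (a • u + b • v : Lp ℝ 2 (volume.restrict (Set.Icc 0 T))) =ᵐ[
      volume.restrict (Set.Icc 0 T)] fun s => a * u s + b * v s := by
  filter_upwards [Lp.coeFn_add (a • u) (b • v), Lp.coeFn_smul a u, Lp.coeFn_smul b v]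
    with s h1 h2 h3
  rw [h1, Pi.add_apply, h2, h3]
  rfl

/-- The `L²` functions with values in `[-1, 1]`. -/
def unitControls (T : ℝ) : Set (Lp ℝ 2 (volume.restrict (Set.Icc 0 T))) :=
  {u | ∀ᵐ s ∂(volume.restrict (Set.Icc 0 T)), |u s| ≤ 1}

theorem isClosed_unitControls (T : ℝ) : IsClosed (unitControls T) := by
  have h1 := memLp_const (p := 2) (μ := volume.restrict (Set.Icc 0 T)) (1 : ℝ)
  have h2 := memLp_const (p := 2) (μ := volume.restrict (Set.Icc 0 T)) (-1 : ℝ)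
  -- As an order interval of `L²`, the set is closed.
  have : unitControls T = Set.Icc (h2.toLp _) (h1.toLp _) := by
    ext u
    rw [Set.mem_Icc, ← Lp.coeFn_le, ← Lp.coeFn_le]
    constructor
    · intro h
      constructor
      · filter_upwards [h, h2.coeFn_toLp] with s hs hc
        rw [hc]; exact (abs_le.1 hs).1
      · filter_upwards [h, h1.coeFn_toLp] with s hs hc
        rw [hc]; exact (abs_le.1 hs).2
    · rintro ⟨ha, hb⟩
      filter_upwards [ha, hb, h1.coeFn_toLp, h2.coeFn_toLp] with s ha hb hc hd
      rw [hd] at ha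
      rw [hc] at hb
      exact abs_le.2 ⟨ha, hb⟩
  rw [this]
  exact isClosed_Icc

theorem isBounded_unitControls (T : ℝ) : Bornology.IsBounded (unitControls T) := by
  have h1 := memLp_const (p := 2) (μ := volume.restrict (Set.Icc 0 T)) (1 : ℝ)
  refine isBounded_iff_forall_norm_le.2 ⟨‖h1.toLp _‖, fun u hu => ?_⟩
  refine Lp.norm_le_norm_of_ae_le ?_
  filter_upwards [hu, h1.coeFn_toLp] with s hs hc
  rw [hc]
  simpa using hs

theorem convex_unitControls (T : ℝ) : Convex ℝ (unitControls T) := by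
  intro u hu v hv a b ha hb hab
  filter_upwards [hu, hv, Lp_linear_combination_ae u v a b] with s h1 h2 h3
  rw [h3]
  calc |a * u s + b * v s| ≤ |a * u s| + |b * v s| := abs_add_le _ _
    _ = a * |u s| + b * |v s| := by rw [abs_mul, abs_mul, abs_of_nonneg ha, abs_of_nonneg hb]
    _ ≤ a * 1 + b * 1 := by gcongr
    _ = 1 := by linarith

theorem continuous_flow_Lp {E : Type*} [NormedAddCommGroup E] [NormedSpace ℝ E] [CompleteSpace E]
    (L : E →L[ℝ] E) (b ξ : E) {T : ℝ} (hT : 0 ≤ T) :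
    Continuous fun u : Lp ℝ 2 (volume.restrict (Set.Icc 0 T)) => flow L b u ξ T := by
  obtain ⟨C, hC, hbound⟩ := exists_norm_flow_le L b T
  refine continuous_of_dist_le_integral hT hC fun u v => ?_
  have hu := intervalIntegrable_coeFn_Lp hT u
  have hv := intervalIntegrable_coeFn_Lp hT v
  have h1 := flow_linear_combination L b ξ ξ 1 (-1) hT hu hv
  have h2 := hbound (fun s => 1 * u s + -1 * v s) 0 T ⟨hT, le_rfl⟩
    ((hu.const_mul 1).add (hv.const_mul (-1)))
  rw [show (1 : ℝ) • ξ + (-1 : ℝ) • ξ = 0 by module] at h1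
  rw [h1] at h2
  simpa [dist_eq_norm, ← sub_eq_add_neg] using h2

variable {n : ℕ} {A : Matrix (Fin n) (Fin n) ℝ} {B : EuclideanSpace ℝ (Fin n)} {N : ℕ}
  {U w : ℕ → ℝ}

theorem IsFeasible.congr {T : ℝ} (hT : 0 ≤ T) {ξ : EuclideanSpace ℝ (Fin n)} {u v : ℝ → ℝ}
    (hu : IsFeasible A B T ξ u) (h : u =ᵐ[volume.restrict (Set.Icc 0 T)] v) :
    IsFeasible A B T ξ v := by
  rw [isFeasible_iff hT] at hu ⊢
  refine ⟨hu.1.congr h, ?_, ?_⟩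
  · filter_upwards [hu.2.1, h] with s hs hsv
    rwa [← hsv]
  · rw [← hu.2.2]
    exact (flow_congr hT (ae_mem_Ioc_of_ae_restrict_Icc h)).symm

theorem exists_isSOAVOptimal (hw : ∀ i ∈ Finset.Icc 1 N, 0 ≤ w i)
    (hsum : ∑ i ∈ Finset.Icc 1 N, w i = 1) {T : ℝ} (hT : 0 ≤ T) {ξ : EuclideanSpace ℝ (Fin n)}
    (hne : ∃ u, IsFeasible A B T ξ u) : ∃ u, IsSOAVOptimal A B N U w T ξ u := by
  set L := Matrix.toEuclideanCLM (𝕜 := ℝ) A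
  let K : Set (Lp ℝ 2 (volume.restrict (Set.Icc 0 T))) :=
    unitControls T ∩ {u | flow L B u ξ T = 0}
  have hfeas : ∀ u ∈ K, IsFeasible A B T ξ u := fun u hu =>
    (isFeasible_iff hT).2 ⟨(Lp.aestronglyMeasurable u).aemeasurable, hu.1, hu.2⟩
  -- Feasibility and cost depend only on the almost-everywhere class, so minimizing over `K` covers
  -- all feasible functions.
  have hrep : ∀ v, IsFeasible A B T ξ v → ∃ u ∈ K, soavCost N U w T u = soavCost N U w T v := by
    intro v hv
    have hmem : MemLp v 2 (volume.restrict (Set.Icc 0 T)) :=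
      MemLp.of_bound hv.1.aestronglyMeasurable 1 hv.2.1
    have hvu := hv.congr hT hmem.coeFn_toLp.symm
    exact ⟨hmem.toLp v, ⟨hvu.2.1, ((isFeasible_iff hT).1 hvu).2.2⟩,
      soavCost_congr hT (ae_mem_Ioc_of_ae_restrict_Icc hmem.coeFn_toLp)⟩
  have hclosed : IsClosed K := (isClosed_unitControls T).inter
    (isClosed_eq (continuous_flow_Lp L B ξ hT) continuous_const)
  have hconv : Convex ℝ K := by
    refine (convex_unitControls T).inter fun u hu v hv a b _ _ hab => ?_
    have h1 := flow_linear_combination L B ξ ξ a b hT (intervalIntegrable_coeFn_Lp hT u)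
      (intervalIntegrable_coeFn_Lp hT v)
    rw [← add_smul, hab, one_smul, Set.mem_ofPred.1 hu, Set.mem_ofPred.1 hv, smul_zero, smul_zero,
      add_zero] at h1
    rw [Set.mem_ofPred, ← h1]
    exact flow_congr hT (ae_mem_Ioc_of_ae_restrict_Icc (Lp_linear_combination_ae u v a b))
  have hcont : Continuous fun u : Lp ℝ 2 (volume.restrict (Set.Icc 0 T)) =>
      soavCost N U w T u := by
    refine continuous_of_dist_le_integral hT (C := 2) (by norm_num) fun u v => ?_
    have hu := intervalIntegrable_coeFn_Lp hT u
    have hv := intervalIntegrable_coeFn_Lp hT v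
    rw [Real.dist_eq, abs_sub_le_iff]
    refine ⟨soavCost_sub_le hw hsum hT hu hv, ?_⟩
    simpa only [abs_sub_comm] using soavCost_sub_le (U := U) hw hsum hT hv hu
  have hcost : ConvexOn ℝ K fun u => soavCost N U w T u := by
    refine ⟨hconv, fun u _ v _ a b ha hb hab => ?_⟩
    dsimp only
    rw [soavCost_congr hT
      (ae_mem_Ioc_of_ae_restrict_Icc (Lp_linear_combination_ae u v a b))]
    exact soavCost_convex hw hsum hT (intervalIntegrable_coeFn_Lp hT u)
      (intervalIntegrable_coeFn_Lp hT v) ha hb hab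
  have hbelow : BddBelow ((fun u : Lp ℝ 2 (volume.restrict (Set.Icc 0 T)) =>
      soavCost N U w T u) '' K) := by
    refine ⟨0, ?_⟩
    rintro _ ⟨u, _, rfl⟩
    dsimp only
    rw [soavCost_eq (intervalIntegrable_coeFn_Lp hT u)]
    exact intervalIntegral.integral_nonneg hT fun s _ => stageCost_nonneg hw _
  have hKne : K.Nonempty := by
    obtain ⟨v, hv⟩ := hne
    obtain ⟨u, hu, _⟩ := hrep v hv
    exact ⟨u, hu⟩
  obtain ⟨p, hp, hmin⟩ := exists_isMinOn_of_convexOn hclosed hKne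
    ((isBounded_unitControls T).subset Set.inter_subset_left) hcont hcost hbelow
  refine ⟨p, hfeas p hp, fun v hv => ?_⟩
  obtain ⟨u, hu, huv⟩ := hrep v hv
  rw [← huv]
  exact hmin u hu

end OptimalControl

/-! ### Shifting a control: feasibility and cost -/

section ShiftedControl

/-- The control `v` on `[0, T]`, advanced by the time `h` and continued by zero. -/
noncomputable def shiftedControl (T h : ℝ) (v : ℝ → ℝ) (s : ℝ) : ℝ :=
  if s ≤ T - h then v (h + s) else 0

theorem ae_shift {T h : ℝ} (hh : 0 ≤ h) {p : ℝ → Prop}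
    (hp : ∀ᵐ s ∂(volume.restrict (Set.Icc 0 T)), p s) :
    ∀ᵐ s ∂(volume.restrict (Set.Icc 0 T)), s ≤ T - h → p (h + s) := by
  rw [ae_restrict_iff' measurableSet_Icc] at hp ⊢
  filter_upwards [(measurePreserving_add_left volume h).quasiMeasurePreserving.ae hp]
    with s hs hsT hle
  exact hs ⟨add_nonneg hh hsT.1, by linarith⟩

theorem ae_ne_real (a : ℝ) : ∀ᵐ s : ℝ, s ≠ a :=
  compl_mem_ae_iff.2 (measure_singleton a)

variable {n : ℕ} {A : Matrix (Fin n) (Fin n) ℝ} {B : EuclideanSpace ℝ (Fin n)} {N : ℕ}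
  {U w : ℕ → ℝ}

/-- The tail of `v` reaches the origin at time `T - h`, and the zero control keeps the state there.
-/
theorem IsFeasible.shifted {T h : ℝ} (hh : 0 ≤ h) (hhT : h ≤ T) {ξ : EuclideanSpace ℝ (Fin n)}
    {v : ℝ → ℝ} (hv : IsFeasible A B T ξ v) :
    IsFeasible A B T (flow (Matrix.toEuclideanCLM (𝕜 := ℝ) A) B v ξ h)
      (shiftedControl T h v) := by
  have hT : 0 ≤ T := hh.trans hhT
  obtain ⟨v₀, hv₀, hvv₀⟩ := hv.1
  have hm : AEMeasurable (shiftedControl T h v) (volume.restrict (Set.Icc 0 T)) := by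
    refine ⟨shiftedControl T h v₀, Measurable.ite measurableSet_Iic
      (hv₀.comp (measurable_const_add h)) measurable_const, ?_⟩
    filter_upwards [ae_shift hh hvv₀] with s hs
    unfold shiftedControl
    split_ifs with hle
    · exact hs hle
    · rfl
  have hb : ∀ᵐ s ∂(volume.restrict (Set.Icc 0 T)), |shiftedControl T h v s| ≤ 1 := by
    filter_upwards [ae_shift hh hv.2.1] with s hs
    unfold shiftedControl
    split_ifs with hle
    · exact hs hle
    · simp
  have hint := intervalIntegrable_of_ae_abs_le hT hm hb
  refine (isFeasible_iff hT).2 ⟨hm, hb, ?_⟩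
  have hTh : 0 ≤ T - h := by linarith
  have h1 := flow_add (A := A) (B := B) hTh hh (by rwa [sub_add_cancel])
    (flow (Matrix.toEuclideanCLM (𝕜 := ℝ) A) B v ξ h) (u := shiftedControl T h v)
  have h2 := flow_add (A := A) (B := B) hh hTh (u := v)
    (by rw [add_sub_cancel]; exact hv.intervalIntegrable hT) ξ
  rw [add_sub_cancel, ((isFeasible_iff hT).1 hv).2.2] at h2
  rw [sub_add_cancel] at h1
  rw [h1, flow_congr (u := shiftedControl T h v) (v := fun s => v (h + s)) hTh, ← h2]
  · refine flow_zero_of_ae_eq_zero hh (Filter.Eventually.of_forall fun s hs => ?_)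
    exact if_neg (by linarith [hs.1])
  · exact Filter.Eventually.of_forall fun s hs => if_pos hs.2

/-- Both costs share the part of `v` on `[h, T]`. The appended zeros cost exactly `h * stageCost N U
w 0`, which is at most the cost of the discarded piece on `[0, h]`. -/
theorem soavCost_shifted_le (hU : U 1 = 0) (hN : 1 ≤ N) (hw : ∀ i ∈ Finset.Icc 1 N, 0 ≤ w i)
    (hsum : ∑ i ∈ Finset.Icc 1 N, w i = 1) {T h : ℝ} (hh : 0 ≤ h) (hhT : h ≤ T) {v : ℝ → ℝ}
    (hv : IntervalIntegrable v volume 0 T)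
    (hs : IntervalIntegrable (shiftedControl T h v) volume 0 T) :
    soavCost N U w T (shiftedControl T h v) ≤ soavCost N U w T v := by
  have hT : 0 ≤ T := hh.trans hhT
  have hTh : 0 ≤ T - h := by linarith
  have hv' := intervalIntegrable_stageCost (U := U) hw hsum hv
  have hs' := intervalIntegrable_stageCost (U := U) hw hsum hs
  have mem : ∀ {a : ℝ}, 0 ≤ a → a ≤ T → a ∈ Set.uIcc 0 T := fun h0 h1 => by
    rw [Set.uIcc_of_le hT]; exact ⟨h0, h1⟩
  have sub : ∀ {a b : ℝ}, 0 ≤ a → a ≤ T → 0 ≤ b → b ≤ T → Set.uIcc a b ⊆ Set.uIcc 0 T :=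
    fun h0 h1 h2 h3 => Set.uIcc_subset_uIcc (mem h0 h1) (mem h2 h3)
  rw [soavCost_eq hv, soavCost_eq hs,
    ← intervalIntegral.integral_add_adjacent_intervals
      (hs'.mono_set (sub le_rfl hT hTh (by linarith)))
      (hs'.mono_set (sub hTh (by linarith) hT le_rfl)),
    ← intervalIntegral.integral_add_adjacent_intervals
      (hv'.mono_set (sub le_rfl hT hh hhT)) (hv'.mono_set (sub hh hhT hT le_rfl))]
  have h1 : ∫ s in (0 : ℝ)..(T - h), stageCost N U w (shiftedControl T h v s) =
      ∫ s in h..T, stageCost N U w (v s) := by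
    have := intervalIntegral.integral_comp_add_left (fun s => stageCost N U w (v s)) h
      (a := 0) (b := T - h)
    rw [add_zero, add_sub_cancel] at this
    rw [← this]
    refine intervalIntegral.integral_congr fun s hs => ?_
    rw [Set.uIcc_of_le hTh] at hs
    simp only [shiftedControl, if_pos hs.2]
  have h2 : ∫ s in (T - h)..T, stageCost N U w (shiftedControl T h v s) =
      h * stageCost N U w 0 := by
    have : ∫ s in (T - h)..T, stageCost N U w (shiftedControl T h v s) =
        ∫ s in (T - h)..T, stageCost N U w 0 := by
      refine intervalIntegral.integral_congr_ae (Filter.Eventually.of_forall fun s hs => ?_)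
      rw [Set.uIoc_of_le (by linarith)] at hs
      simp only [shiftedControl, if_neg (not_le.2 hs.1)]
    rw [this]
    simp
  have h3 : h * stageCost N U w 0 ≤ ∫ s in (0 : ℝ)..h, stageCost N U w (v s) := by
    have := intervalIntegral.integral_mono_on hh
      (intervalIntegrable_const (c := stageCost N U w 0))
      (hv'.mono_set (sub le_rfl hT hh hhT)) (fun s _ => by
        have := stageCost_zero_add_le hU hN hw (v s)
        have hpos : 0 ≤ 2 * w 1 * |v s| :=
          mul_nonneg (mul_nonneg zero_le_two (hw 1 (Finset.mem_Icc.2 ⟨le_rfl, hN⟩)))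
            (abs_nonneg _)
        linarith)
    simpa using this
  rw [h1, h2]
  linarith

end ShiftedControl

/-! ### The closed loop: existence and decrease of the cost -/

section ClosedLoop

variable {n : ℕ} {A : Matrix (Fin n) (Fin n) ℝ} {B : EuclideanSpace ℝ (Fin n)} {N : ℕ}
  {U w : ℕ → ℝ} {T : ℝ} {t : ℕ → ℝ}

theorem IsSampling.nonneg (ht : IsSampling T t) (k : ℕ) : 0 ≤ t k :=
  ht.1 ▸ ht.2.1.monotone (Nat.zero_le k)

theorem IsSampling.step_nonneg (ht : IsSampling T t) (k : ℕ) : 0 ≤ t (k + 1) - t k :=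
  sub_nonneg.2 (ht.2.1 (Nat.lt_succ_self k)).le

theorem IsSampling.step_le (ht : IsSampling T t) (k : ℕ) : t (k + 1) - t k ≤ T := by
  obtain ⟨τ, _, h⟩ := ht.2.2
  exact (h k).2

/-- The uniform gap `τ` gives `k * τ ≤ t k`, so the sampling instants cannot accumulate. -/
theorem IsSampling.exists_lt (ht : IsSampling T t) (s : ℝ) : ∃ k, s < t k := by
  obtain ⟨h0, -, τ, hτ, h⟩ := ht
  have hk : ∀ k : ℕ, k * τ ≤ t k := by
    intro k
    induction k with
    | zero => simp [h0]
    | succ k ih =>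
      have := (h k).1
      push_cast
      linarith
  obtain ⟨k, hsk⟩ := exists_nat_gt (s / τ)
  exact ⟨k, ((div_lt_iff₀ hτ).1 hsk).trans_le (hk k)⟩

theorem IsSampling.exists_mem_Ico (ht : IsSampling T t) {s : ℝ} (hs : 0 ≤ s) :
    ∃ k, s ∈ Set.Ico (t k) (t (k + 1)) := by
  classical
  have hex := ht.exists_lt s
  obtain ⟨k, hk⟩ : ∃ k, Nat.find hex = k + 1 := by
    refine Nat.exists_eq_succ_of_ne_zero fun h => ?_
    have := Nat.find_spec hex
    rw [h, ht.1] at this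
    exact absurd hs (not_le.2 this)
  refine ⟨k, not_lt.1 (Nat.find_min hex (by omega)), ?_⟩
  rw [← hk]
  exact Nat.find_spec hex

theorem IsSampling.unique_of_mem_Ico (ht : IsSampling T t) {s : ℝ} {j k : ℕ}
    (hj : s ∈ Set.Ico (t j) (t (j + 1))) (hk : s ∈ Set.Ico (t k) (t (k + 1))) : j = k := by
  have h1 : j < k + 1 := ht.2.1.lt_iff_lt.1 (hj.1.trans_lt hk.2)
  have h2 : k < j + 1 := ht.2.1.lt_iff_lt.1 (hk.1.trans_lt hj.2)
  omega

theorem exists_glued_control (ht : IsSampling T t) (v : ℕ → ℝ → ℝ) :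
    ∃ u : ℝ → ℝ, ∀ k, ∀ s ∈ Set.Ico (t k) (t (k + 1)), u s = v k (s - t k) := by
  have : ∀ s : ℝ, ∃ k, 0 ≤ s → s ∈ Set.Ico (t k) (t (k + 1)) := by
    intro s
    by_cases hs : 0 ≤ s
    · obtain ⟨k, hk⟩ := ht.exists_mem_Ico hs
      exact ⟨k, fun _ => hk⟩
    · exact ⟨0, fun h => absurd h hs⟩
  choose idx hidx using this
  refine ⟨fun s => v (idx s) (s - t (idx s)), fun k s hs => ?_⟩
  simp only [ht.unique_of_mem_Ico (hidx s ((ht.nonneg k).trans hs.1)) hs]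

theorem ae_glued_eq {v : ℕ → ℝ → ℝ} {u : ℝ → ℝ}
    (hu : ∀ k, ∀ s ∈ Set.Ico (t k) (t (k + 1)), u s = v k (s - t k)) (k : ℕ) :
    ∀ᵐ s, s ∈ Set.Ioc 0 (t (k + 1) - t k) → u (t k + s) = v k s := by
  -- The right endpoint already belongs to the next sampling interval and is discarded as a null
  -- set.
  filter_upwards [ae_ne_real (t (k + 1) - t k)] with s hne hs
  have hlt := lt_of_le_of_ne hs.2 hne
  rw [hu k (t k + s) ⟨by linarith [hs.1], by linarith⟩, add_sub_cancel_left]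

theorem intervalIntegrable_glued (ht : IsSampling T t) (hT : 0 ≤ T) {v : ℕ → ℝ → ℝ} {u : ℝ → ℝ}
    (hv : ∀ k, IntervalIntegrable (v k) volume 0 T)
    (hu : ∀ k, ∀ s ∈ Set.Ico (t k) (t (k + 1)), u s = v k (s - t k)) {S : ℝ} (hS : 0 ≤ S) :
    IntervalIntegrable u volume 0 S := by
  have key : ∀ k, IntervalIntegrable u volume 0 (t k) := by
    intro k
    induction k with
    | zero => rw [ht.1]
    | succ k ih =>
      refine ih.trans ?_
      have hle := (ht.2.1 (Nat.lt_succ_self k)).le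
      have h1 : IntervalIntegrable (v k) volume 0 (t (k + 1) - t k) := by
        refine (hv k).mono_set ?_
        rw [Set.uIcc_of_le (ht.step_nonneg k), Set.uIcc_of_le hT]
        exact Set.Icc_subset_Icc_right (ht.step_le k)
      have h2 := h1.comp_sub_right (t k)
      rw [zero_add, sub_add_cancel] at h2
      refine h2.congr_ae ?_
      rw [Filter.EventuallyEq, ae_restrict_iff' measurableSet_uIoc, Set.uIoc_of_le hle]
      filter_upwards [ae_ne_real (t (k + 1))] with s hne hs
      exact (hu k s ⟨hs.1.le, lt_of_le_of_ne hs.2 hne⟩).symm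
  obtain ⟨k, hk⟩ := ht.exists_lt S
  refine (key k).mono_set ?_
  rw [Set.uIcc_of_le hS, Set.uIcc_of_le (hS.trans hk.le)]
  exact Set.Icc_subset_Icc_right hk.le

theorem isTrajectory_flow_Ici {u : ℝ → ℝ}
    (hu : ∀ S : ℝ, 0 ≤ S → IntervalIntegrable u volume 0 S) (ξ : EuclideanSpace ℝ (Fin n)) :
    IsTrajectory A B u (Set.Ici 0) (flow (Matrix.toEuclideanCLM (𝕜 := ℝ) A) B u ξ) := by
  have h : ∀ S : ℝ, 0 ≤ S → IsTrajectory A B u (Set.Icc 0 S)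
      (flow (Matrix.toEuclideanCLM (𝕜 := ℝ) A) B u ξ) := fun S hS =>
    isTrajectory_flow hS (hu S hS) ξ
  refine ⟨fun s hs => ?_, fun s hs => (h s hs).2 s ⟨hs, le_rfl⟩⟩
  have hs0 : (0 : ℝ) ≤ s := hs
  refine ((h (s + 1) (by linarith)).1 s ⟨hs, by linarith⟩).mono_of_mem_nhdsWithin ?_
  filter_upwards [self_mem_nhdsWithin, mem_nhdsWithin_of_mem_nhds
    (Iic_mem_nhds (show s < s + 1 by linarith))] with r h1 h2 using ⟨h1, h2⟩

/-- From a state that can be steered to the origin the closed loop has a trajectory. -/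
theorem exists_isMPCTrajectory (hw : ∀ i ∈ Finset.Icc 1 N, 0 ≤ w i)
    (hsum : ∑ i ∈ Finset.Icc 1 N, w i = 1) (hT : 0 ≤ T) (ht : IsSampling T t)
    {ξ : EuclideanSpace ℝ (Fin n)} (hξ : ∃ u, IsFeasible A B T ξ u) :
    ∃ x, IsMPCTrajectory A B N U w T t ξ x := by
  -- The choice of control is made total, with value zero at infeasible states, so that the sampled
  -- states `z` can be defined by recursion before feasibility is proved along them.
  have hopt : ∀ η : EuclideanSpace ℝ (Fin n), ∃ v, (∃ u, IsFeasible A B T η u) →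
      IsSOAVOptimal A B N U w T η v := by
    intro η
    by_cases hη : ∃ u, IsFeasible A B T η u
    · obtain ⟨v, hv⟩ := exists_isSOAVOptimal (U := U) hw hsum hT hη
      exact ⟨v, fun _ => hv⟩
    · exact ⟨0, fun h => absurd h hη⟩
  choose σ hσ using hopt
  set L := Matrix.toEuclideanCLM (𝕜 := ℝ) A with hL
  let z : ℕ → EuclideanSpace ℝ (Fin n) := fun k =>
    Nat.rec ξ (fun k η => flow L B (σ η) η (t (k + 1) - t k)) k
  have hz : ∀ k, z (k + 1) = flow L B (σ (z k)) (z k) (t (k + 1) - t k) := fun _ => rfl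
  have hfeas : ∀ k, ∃ u, IsFeasible A B T (z k) u := by
    intro k
    induction k with
    | zero => exact hξ
    | succ k ih =>
      rw [hz]
      exact ⟨_, (hσ _ ih).1.shifted (ht.step_nonneg k) (ht.step_le k)⟩
  have hv : ∀ k, IsSOAVOptimal A B N U w T (z k) (σ (z k)) := fun k => hσ _ (hfeas k)
  obtain ⟨u, hu⟩ := exists_glued_control ht fun k => σ (z k)
  have hint : ∀ S : ℝ, 0 ≤ S → IntervalIntegrable u volume 0 S := fun S hS =>
    intervalIntegrable_glued ht hT (fun k => (hv k).1.intervalIntegrable hT) hu hS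
  have hstate : ∀ k, flow L B u ξ (t k) = z k := by
    intro k
    induction k with
    | zero => exact ht.1 ▸ flow_zero_time _ _ _ _
    | succ k ih =>
      have h1 := flow_add (A := A) (B := B) (ht.nonneg k) (ht.step_nonneg k)
        (hint _ (add_nonneg (ht.nonneg k) (ht.step_nonneg k))) ξ
      rw [add_sub_cancel, ← hL, ih] at h1
      rw [h1, hz]
      exact flow_congr (ht.step_nonneg k) (ae_glued_eq hu k)
  refine ⟨flow L B u ξ, flow_zero_time _ _ _ _, fun k => σ (z k), u, fun k => ?_, hu,
    isTrajectory_flow_Ici hint ξ⟩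
  rw [hstate k]
  exact hv k

theorem mpc_eq_flow {v : ℕ → ℝ → ℝ} {u : ℝ → ℝ} {x : ℝ → EuclideanSpace ℝ (Fin n)}
    (ht : IsSampling T t) (hu : ∀ k, ∀ s ∈ Set.Ico (t k) (t (k + 1)), u s = v k (s - t k))
    (hx : IsTrajectory A B u (Set.Ici 0) x) (k : ℕ) {s : ℝ}
    (hs : s ∈ Set.Icc 0 (t (k + 1) - t k)) :
    x (t k + s) = flow (Matrix.toEuclideanCLM (𝕜 := ℝ) A) B (v k) (x (t k)) s := by
  have h1 : IsTrajectory A B u (Set.Icc 0 (t k + (t (k + 1) - t k))) x :=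
    hx.mono Set.Icc_subset_Ici_self
  have h2 := (h1.comp_add (ht.nonneg k)).eq_flow hs
  rw [h2, add_zero]
  refine flow_congr hs.1 ?_
  filter_upwards [ae_glued_eq hu k] with r hr hrs using hr ⟨hrs.1, hrs.2.trans hs.2⟩

/-- Along the closed loop the optimal cost does not increase. -/
theorem soavCost_antitone_of_mpc (hU : U 1 = 0) (hN : 1 ≤ N)
    (hw : ∀ i ∈ Finset.Icc 1 N, 0 ≤ w i) (hsum : ∑ i ∈ Finset.Icc 1 N, w i = 1) (hT : 0 ≤ T)
    (ht : IsSampling T t) {v : ℕ → ℝ → ℝ} {u : ℝ → ℝ} {x : ℝ → EuclideanSpace ℝ (Fin n)}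
    (hv : ∀ k, IsSOAVOptimal A B N U w T (x (t k)) (v k))
    (hu : ∀ k, ∀ s ∈ Set.Ico (t k) (t (k + 1)), u s = v k (s - t k))
    (hx : IsTrajectory A B u (Set.Ici 0) x) :
    Antitone fun k => soavCost N U w T (v k) := by
  refine antitone_nat_of_succ_le fun k => ?_
  have hnext := mpc_eq_flow ht hu hx k ⟨ht.step_nonneg k, le_rfl⟩
  rw [add_sub_cancel] at hnext
  -- The shifted control competes with the optimum `v (k + 1)` at the next sampled state.
  have hfeas := (hv k).1.shifted (ht.step_nonneg k) (ht.step_le k)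
  rw [← hnext] at hfeas
  exact ((hv (k + 1)).2 _ hfeas).trans (soavCost_shifted_le hU hN hw hsum (ht.step_nonneg k)
    (ht.step_le k) ((hv k).1.intervalIntegrable hT) (hfeas.intervalIntegrable hT))

end ClosedLoop

/-- Stability of receding-horizon SOAV model predictive control. The magnitudes are
`0 = U 1 < U 2 < ⋯ < U N = 1` and the weights `w 1, …, w N`; values of `U` and `w` at other
indices play no role. -/
theorem theorem6 {n : ℕ} (A : Matrix (Fin n) (Fin n) ℝ) (B : EuclideanSpace ℝ (Fin n))
    (N : ℕ) (U w : ℕ → ℝ) (T : ℝ) (hT : 0 < T)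
    (hU_min : U 1 = 0) (hU_mono : StrictMonoOn U (Set.Icc 1 N)) (hU_max : U N = 1)
    (hw_nonneg : ∀ i ∈ Finset.Icc 1 N, 0 ≤ w i) (hw_pos : 0 < w 1)
    (hw_sum : ∑ i ∈ Finset.Icc 1 N, w i = 1)
    (hAB : IsControllable A B)
    (t : ℕ → ℝ) (ht : IsSampling T t) :
    IsMPCLyapunovStable A B N U w T t := by
  have hN : 1 ≤ N := by
    by_contra h
    rw [Finset.Icc_eq_empty h, Finset.sum_empty] at hw_sum
    exact zero_ne_one hw_sum
  obtain ⟨c, hc, hctrl⟩ := exists_continuous_control hAB hT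
  obtain ⟨C, hC, hflow⟩ := exists_norm_flow_le_of_flow_eq_zero
    (Matrix.toEuclideanCLM (𝕜 := ℝ) A) B T
  have hsmall : ∀ ξ : EuclideanSpace ℝ (Fin n), c * ‖ξ‖ ≤ 1 → ∃ u, IsFeasible A B T ξ u ∧
      ∫ s in (0 : ℝ)..T, |u s| ≤ T * (c * ‖ξ‖) := by
    intro ξ hξ
    obtain ⟨u, hu, huT, hbound⟩ := hctrl ξ
    refine ⟨u, (isFeasible_iff hT.le).2 ⟨hu.aemeasurable, ?_, huT⟩, ?_⟩
    · exact (ae_restrict_iff' measurableSet_Icc).2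
        (Filter.Eventually.of_forall fun s hs => (hbound s hs).trans hξ)
    · have := intervalIntegral.integral_mono_on hT.le (hu.abs.intervalIntegrable _ _)
        (intervalIntegrable_const (μ := volume)) hbound
      rwa [intervalIntegral.integral_const, sub_zero, smul_eq_mul] at this
  intro ε hε
  -- The first bound makes the linear control admissible, `c * ‖ξ‖ ≤ 1`; the second makes the final
  -- estimate smaller than `ε`. Adding `1` keeps the denominators positive when `c` or `C` vanishes.
  refine ⟨min (1 / (c + 1)) (ε * w 1 / (C * T * c + 1)), by positivity, fun ξ hξ => ?_⟩
  have hξ1 : c * ‖ξ‖ ≤ 1 := by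
    have := (lt_div_iff₀ (by positivity)).1 (hξ.trans_le (min_le_left _ _))
    nlinarith [norm_nonneg ξ]
  have hξ2 : C * (T * (c * ‖ξ‖)) < ε * w 1 := by
    have := (lt_div_iff₀ (by positivity)).1 (hξ.trans_le (min_le_right _ _))
    nlinarith [norm_nonneg ξ]
  obtain ⟨u₀, hu₀, hu₀c⟩ := hsmall ξ hξ1
  refine ⟨exists_isMPCTrajectory hw_nonneg hw_sum hT.le ht ⟨u₀, hu₀⟩, ?_⟩
  rintro x ⟨hx0, v, u, hv, hu, hx⟩ s hs
  obtain ⟨k, hk⟩ := ht.exists_mem_Ico hs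
  have hI := (hv k).1.intervalIntegrable hT.le
  have hmem : s - t k ∈ Set.Icc 0 (t (k + 1) - t k) :=
    ⟨sub_nonneg.2 hk.1, sub_le_sub_right hk.2.le _⟩
  have hxs := mpc_eq_flow ht hu hx k hmem
  rw [add_sub_cancel] at hxs
  have hnorm := hflow (v k) (x (t k)) hI ((isFeasible_iff hT.le).1 (hv k).1).2.2 (s - t k)
    ⟨hmem.1, hmem.2.trans (ht.step_le k)⟩
  rw [← hxs] at hnorm
  have hv0 := hv 0
  rw [ht.1, hx0] at hv0
  have h1 := le_soavCost hU_min hN hw_nonneg hw_sum hT.le hI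
  have h2 : soavCost N U w T (v k) ≤ soavCost N U w T (v 0) :=
    soavCost_antitone_of_mpc hU_min hN hw_nonneg hw_sum hT.le ht hv hu hx (Nat.zero_le k)
  have h3 := hv0.2 u₀ hu₀
  have h4 := soavCost_le (U := U) hw_nonneg hw_sum hT.le (hu₀.intervalIntegrable hT.le)
  -- Chain `h1` to `h4`: the cost of `v k` is at most that of `v 0`, hence at most that of `u₀`. The
  -- offset `T * stageCost N U w 0` and the factor `2` cancel.
  have h5 : w 1 * (∫ r in (0 : ℝ)..T, |v k r|) ≤ T * (c * ‖ξ‖) := by linarith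
  have h6 : w 1 * ‖x s‖ < w 1 * ε := by
    calc w 1 * ‖x s‖ ≤ w 1 * (C * ∫ r in (0 : ℝ)..T, |v k r|) := by gcongr
      _ = C * (w 1 * ∫ r in (0 : ℝ)..T, |v k r|) := by ring
      _ ≤ C * (T * (c * ‖ξ‖)) := by gcongr
      _ < ε * w 1 := hξ2
      _ = w 1 * ε := mul_comm _ _
  exact lt_of_mul_lt_mul_left h6 hw_pos.le
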